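/- Let $0<\gamma<\frac12$ and $0<\beta<\tilde\beta<\beta_c:=(\frac14-\frac\gamma2)\vee 0$, and let $\epsilon>0$. For $n\in\mathbb N$ let $\mathscr G_n$ be the random graph with vertex set $\{1,\dots,n\}$ in which each unordered pair $\{i,j\}$ of distinct vertices is an edge independently with probability $\frac1n\kappa(\frac in,\frac jn)\wedge 1$, where $\kappa(x,y)=\beta (x\vee y)^{\gamma-1}(x\wedge y)^{-\gamma}$. Let $O_n$ be a uniformly chosen vertex, independent of $\mathscr G_n$, and let $\mathscr C_n(v)$ be the connected component of the vertex $v$ in $\mathscr G_n$. Let $X$ be a standard exponential random variable. Independently of $X$, attach to every finite sequence $v=(v_1,\dots,v_k)$ of natural numbers (including the empty sequence $\varnothing$, the root) an independent Poisson process on $\mathbb R$ with intensity measure $$\tilde\pi(dx)=\tilde\beta\big(e^{\gamma x}\mathbf 1_{x>0}+e^{(1-\gamma)x}\mathbf 1_{x<0}\big)\,dx,$$ with points $P_v(1)\le P_v(2)\le\cdots$ in increasing order. The particle $v$ of the branching random walk started in $-X$ has position $$V(v)=-X+\sum_{i=1}^{|v|}P_{(v_1,\dots,v_{i-1})}(v_i).$$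 The killed branching random walk $\mathscr T_{0,1}(-X)$ is the set of all $v$ such that $v$ and all its ancestors have position in $(-\infty,0]$, and $|\mathscr T_{0,1}(-X)|$ is the number of its particles. Then there exists a probability space carrying $X$ and the Poisson processes $(P_v)$ as above (and hence $\mathscr T_{0,1}(-X)$) and, for all sufficiently large $n$, a graph $\mathscr G_n$ and a vertex $O_n$ with the laws described above (in general dependent on $\mathscr T_{0,1}(-X)$), such that, for all sufficiently large $n$, $$\mathbb P\big(|\mathscr C_n(O_n)|>|\mathscr T_{0,1}(-X)|\big)\le \mathbb P\big(\exists\, v\in\mathscr T_{0,1}(-X)\text{ with } V(v)\le -(1-\epsilon)\log n\big).$$ -/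

import Mathlib

open MeasureTheory ProbabilityTheory Filter

namespace PrefAttach

noncomputable section

/-- The critical edge density. -/
def betaC (γ : ℝ) : ℝ := max (1 / 4 - γ / 2) 0

/-- The preferential attachment kernel on `(0,1] × (0,1]`. -/
def kernel (γ β x y : ℝ) : ℝ := β * (max x y) ^ (γ - 1) * (min x y) ^ (-γ)

/-- The number in `{1, …, n}` of a vertex of `Fin n`. -/
def label {n : ℕ} (i : Fin n) : ℝ := (i : ℕ) + 1

/-- The probability that `i` and `j` are joined in the graph with `n` vertices. -/
def edgeProb (γ β : ℝ) (n : ℕ) (i j : Fin n) : ℝ :=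
  min (1 / (n : ℝ) * kernel γ β (label i / n) (label j / n)) 1

/-- `G` is the inhomogeneous random graph of preferential attachment type: the unordered pairs of
distinct vertices (indexed by `i < j`) are edges independently of each other, with the given
probabilities. -/
structure IsPARandomGraph {Ω : Type*} [MeasurableSpace Ω] (P : Measure Ω) (γ β : ℝ) {n : ℕ}
    (G : Ω → SimpleGraph (Fin n)) : Prop where
  measurable : Measurable G
  prob_adj : ∀ i j : Fin n, i < j → P {ω | (G ω).Adj i j} = ENNReal.ofReal (edgeProb γ β n i j)
  indep : iIndepSet (fun e : {e : Fin n × Fin n // e.1 < e.2} =>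
    {ω | (G ω).Adj e.1.1 e.1.2}) P

/-- `O` is a uniformly chosen vertex, independent of the random graph `G`. -/
structure IsIndepUniformVertex {Ω : Type*} [MeasurableSpace Ω] (P : Measure Ω) {n : ℕ}
    (G : Ω → SimpleGraph (Fin n)) (O : Ω → Fin n) : Prop where
  measurable : Measurable O
  prob_eq : ∀ i : Fin n, P {ω | O ω = i} = 1 / (n : ENNReal)
  indep : IndepFun O G P

/-- The number of vertices in the connected component of `v`. -/
def componentSize {n : ℕ} (G : SimpleGraph (Fin n)) (v : Fin n) : ℕ∞ :=
  (G.connectedComponentMk v).supp.encard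

/-- The intensity measure `β (e^{γ x} 1_{x > 0} + e^{(1 - γ) x} 1_{x < 0}) dx`. -/
def intensity (γ β : ℝ) : Measure ℝ :=
  volume.withDensity fun x => ENNReal.ofReal
    (β * ((Set.Ioi (0 : ℝ)).indicator (fun t => Real.exp (γ * t)) x
      + (Set.Iio (0 : ℝ)).indicator (fun t => Real.exp ((1 - γ) * t)) x))

/-- `p 0 ≤ p 1 ≤ p 2 ≤ …` are the points, in increasing order, of a Poisson point process with
intensity measure `ν`: the numbers of points in disjoint Borel sets of finite intensity are
independent, and Poisson distributed with the intensities of the sets as parameters. -/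
structure IsOrderedPoissonProcess {Ω : Type*} [MeasurableSpace Ω] (P : Measure Ω) (ν : Measure ℝ)
    (p : Ω → ℕ → ℝ) : Prop where
  measurable : Measurable p
  monotone : ∀ᵐ ω ∂P, Monotone (p ω)
  counts : ∀ (m : ℕ) (B : Fin m → Set ℝ) (c : Fin m → ℕ),
    (∀ i, MeasurableSet (B i)) → Pairwise (fun i j => Disjoint (B i) (B j)) →
    (∀ i, ν (B i) ≠ ⊤) →
    P {ω | ∀ i, {k | p ω k ∈ B i}.encard = (c i : ℕ∞)}
      = ∏ i, poissonMeasure (ν (B i)).toNNReal {c i}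

/-- The independent offspring displacements of a branching random walk with Poisson offspring: to
every Ulam–Harris label (a finite sequence of natural numbers) an independent sample of the
ordered Poisson process with intensity measure `ν` is attached. -/
structure IsPoissonDisplacements {Ω : Type*} [MeasurableSpace Ω] (P : Measure Ω) (ν : Measure ℝ)
    (D : List ℕ → Ω → ℕ → ℝ) : Prop where
  poisson : ∀ v, IsOrderedPoissonProcess P ν (D v)
  indep : iIndepFun D P

/-- The position `V(v) = x + ∑_{i = 1}^{|v|} d_{(v_1, …, v_{i-1})}(v_i)` of the particle with
label `v`, when the displacements are `d` and the root is at `x`. -/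
def position (x : ℝ) (d : List ℕ → ℕ → ℝ) (v : List ℕ) : ℝ :=
  x + ∑ i : Fin v.length, d (v.take i) (v.get i)

/-- The particles of the killed branching random walk `𝒯_{0,1}(x)`: particles located in `(0, ∞)`
are killed together with all their descendants, so that a label survives when it and all its
ancestors, including the root, are located in `(-∞, 0]`. -/
def killedWalk (x : ℝ) (d : List ℕ → ℕ → ℝ) : Set (List ℕ) :=
  {v | ∀ i ≤ v.length, position x d (v.take i) ≤ 0}

end

end PrefAttach

namespace PrefAttach

/-! Give vertex `i` of the graph the positions `z` for which `exp z` lies in the `i`-th interval of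
length `1/n`. Since `exp (-X)` is uniform, a walk started in `-X` picks each vertex with probability
`1/n`. Seen from any point of the cell of `a`, the walk's intensity gives the cell of `j` a mass of
at least `β'/β` times `q`, where `q = β (max label)^(γ-1) (min label)^(-γ)` bounds the edge
probability. As `q ≤ 1 - exp (-(β'/β) q)` for small `q`, a particle in the cell of `a` hits the cell
of `j` at least as likely as `a` and `j` are joined, once the label of `a` exceeds `n^ε` and `n` is
large. The remaining vertices have their cells below `-(1-ε) log n`, so reaching one of them
corresponds to the event on the right-hand side.

Exploring the component vertex by vertex, and the walk particle by particle, gives by induction on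
`k` (`labelsLaw_reachEvent_le`) that the component has more than `k` vertices with at most the
probability that the walk has more than `k` particles or enters the low region. Hence the component
size is stochastically dominated by `cappedSize`, which is at most the number of particles unless
the low region is entered. `exists_monotone_coupling` then builds the graph and the vertex on the
space of the walk, enlarged by one uniform variable.

The ordered Poisson process itself is constructed in `exists_isOrderedPoissonProcess` by superposing
independent Poisson clusters. -/

/-! ### Finite superpositions of Poisson clusters -/

/-- The number of points in `B` of the cluster consisting of the first `x.1` terms of `x.2`. -/
noncomputable def clusterCount (x : ℕ × (ℕ → ℝ)) (B : Set ℝ) : ℕ :=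
  ∑ i ∈ Finset.range x.1, B.indicator 1 (x.2 i)

/-- The law of a Poisson number of independent points with common distribution `ρ`. -/
noncomputable def clusterLaw (r : NNReal) (ρ : Measure ℝ) [IsProbabilityMeasure ρ] :
    Measure (ℕ × (ℕ → ℝ)) :=
  (poissonMeasure r).prod (Measure.infinitePi fun _ => ρ)

instance (r : NNReal) (ρ : Measure ℝ) [IsProbabilityMeasure ρ] :
    IsProbabilityMeasure (clusterLaw r ρ) := by
  unfold clusterLaw; infer_instance

theorem measurable_clusterCount {B : Set ℝ} (hB : MeasurableSet B) :
    Measurable fun x => clusterCount x B := by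
  refine measurable_from_prod_countable_right fun n => ?_
  unfold clusterCount
  refine Finset.measurable_fun_sum (f := fun i (y : ℕ → ℝ) => B.indicator (1 : ℝ → ℕ) (y i))
    (Finset.range n) fun i _ => ?_
  exact (measurable_one.indicator hB).comp (measurable_pi_apply i)

theorem measurable_cluster_prod {g : ℝ → ℂ} (hg : Measurable g) :
    Measurable fun x : ℕ × (ℕ → ℝ) => ∏ i ∈ Finset.range x.1, g (x.2 i) := by
  refine measurable_from_prod_countable_right fun n => ?_
  exact Finset.measurable_fun_prod (f := fun i (y : ℕ → ℝ) => g (y i))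
    (Finset.range n) fun i _ => hg.comp (measurable_pi_apply i)

theorem integral_eval_infinitePi {ι α : Type*} [MeasurableSpace α] (μ : ι → Measure α)
    [∀ i, IsProbabilityMeasure (μ i)] (i : ι) {g : α → ℂ} (hg : Measurable g) :
    ∫ x, g (x i) ∂(Measure.infinitePi μ) = ∫ y, g y ∂(μ i) := by
  have h := integral_map (μ := Measure.infinitePi μ) (φ := fun x => x i) (f := g)
    (measurable_pi_apply i).aemeasurable (by
      exact hg.stronglyMeasurable.aestronglyMeasurable)
  rw [← h]
  congr 1
  exact (measurePreserving_eval_infinitePi μ i).map_eq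

theorem integral_infinitePi_prod_range (ρ : Measure ℝ) [IsProbabilityMeasure ρ] {g : ℝ → ℂ}
    (hg : Measurable g) (n : ℕ) :
    ∫ y, ∏ i ∈ Finset.range n, g (y i) ∂(Measure.infinitePi fun _ : ℕ => ρ)
      = (∫ y, g y ∂ρ) ^ n := by
  have hind : iIndepFun (fun (i : Fin n) (y : ℕ → ℝ) => g (y i))
      (Measure.infinitePi fun _ : ℕ => ρ) :=
    (iIndepFun_infinitePi (P := fun _ : ℕ => ρ) (X := fun _ => g) fun _ => hg).precomp
      Fin.val_injective
  have h := hind.integral_fun_prod_eq_prod_integral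
    (fun i => (hg.comp (measurable_pi_apply _)).aestronglyMeasurable)
  simp_rw [Finset.prod_range]
  rw [h]
  simp [fun i : Fin n => integral_eval_infinitePi (fun _ : ℕ => ρ) i hg]

/-- Given `n` points, the product integrates to the `n`-th power of `∫ g`; averaging over `n` is the
generating function of the Poisson law. -/
theorem integral_clusterLaw (r : NNReal) (ρ : Measure ℝ) [IsProbabilityMeasure ρ] {g : ℝ → ℂ}
    (hg : Measurable g) (hg1 : ∀ y, ‖g y‖ ≤ 1) :
    ∫ x, ∏ i ∈ Finset.range x.1, g (x.2 i) ∂(clusterLaw r ρ)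
      = Complex.exp (r * (∫ y, g y ∂ρ - 1)) := by
  have hint : Integrable (fun x : ℕ × (ℕ → ℝ) => ∏ i ∈ Finset.range x.1, g (x.2 i))
      (clusterLaw r ρ) := by
    refine Integrable.of_bound (measurable_cluster_prod hg).aestronglyMeasurable 1 (ae_of_all _ ?_)
    intro x
    rw [norm_prod]
    exact Finset.prod_le_one (fun _ _ => norm_nonneg _) fun _ _ => hg1 _
  unfold clusterLaw at hint ⊢
  rw [integral_prod _ hint]
  simp_rw [integral_infinitePi_prod_range ρ hg]
  set z : ℂ := ∫ y, g y ∂ρ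
  rw [integral_poissonMeasure, mul_sub, mul_one, sub_eq_neg_add, Complex.exp_add]
  have hz := (NormedSpace.expSeries_div_hasSum_exp (r * z)).tsum_eq
  rw [← Complex.exp_eq_exp_ℂ] at hz
  rw [← hz, ← tsum_mul_left]
  congr with n
  rw [mul_pow, Complex.real_smul]
  push_cast
  ring

/-- The number of points in `B` of the first `K` clusters. -/
noncomputable def partialCount (K : ℕ) (ω : ℕ → ℕ × (ℕ → ℝ)) (B : Set ℝ) : ℕ :=
  ∑ m ∈ Finset.range K, clusterCount (ω m) B

theorem measurable_partialCount (K : ℕ) {B : Set ℝ} (hB : MeasurableSet B) :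
    Measurable fun ω => partialCount K ω B :=
  Finset.measurable_fun_sum _ fun m _ =>
    (measurable_clusterCount hB).comp (measurable_pi_apply m)

section

variable (r : ℕ → NNReal) (ρ : ℕ → Measure ℝ) [∀ m, IsProbabilityMeasure (ρ m)]

/-- The law of a sequence of independent Poisson clusters. -/
noncomputable def clustersLaw : Measure (ℕ → ℕ × (ℕ → ℝ)) :=
  Measure.infinitePi fun m => clusterLaw (r m) (ρ m)

instance : IsProbabilityMeasure (clustersLaw r ρ) := by
  unfold clustersLaw; infer_instance

theorem integral_clustersLaw {g : ℝ → ℂ} (hg : Measurable g) (hg1 : ∀ y, ‖g y‖ ≤ 1) (K : ℕ) :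
    ∫ ω, ∏ m ∈ Finset.range K, ∏ i ∈ Finset.range (ω m).1, g ((ω m).2 i) ∂(clustersLaw r ρ)
      = Complex.exp (∑ m ∈ Finset.range K, r m * (∫ y, g y ∂(ρ m) - 1)) := by
  set F : ℕ × (ℕ → ℝ) → ℂ := fun x => ∏ i ∈ Finset.range x.1, g (x.2 i) with hF
  have hFm : Measurable F := measurable_cluster_prod hg
  have hind : iIndepFun (fun (m : Fin K) (ω : ℕ → ℕ × (ℕ → ℝ)) => F (ω m)) (clustersLaw r ρ) :=
    (iIndepFun_infinitePi (P := fun m => clusterLaw (r m) (ρ m)) (X := fun _ => F)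
      fun _ => hFm).precomp Fin.val_injective
  have h := hind.integral_fun_prod_eq_prod_integral
    (fun i => (hFm.comp (measurable_pi_apply _)).aestronglyMeasurable)
  have h2 : ∀ m : ℕ, ∫ ω, F (ω m) ∂(clustersLaw r ρ)
      = Complex.exp (r m * (∫ y, g y ∂(ρ m) - 1)) := by
    intro m
    rw [← integral_clusterLaw (r m) (ρ m) hg hg1, clustersLaw]
    exact integral_eval_infinitePi (fun m => clusterLaw (r m) (ρ m)) m hFm
  rw [Complex.exp_sum]
  simp_rw [Finset.prod_range]
  simp_rw [hF, Finset.prod_range] at h h2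
  rw [h]
  exact Finset.prod_congr rfl fun m _ => h2 m

/-- Compare characteristic functions: that of the vector of counts is an integral of a product over
points, and disjointness of the sets makes its exponent a sum with one Poisson term per set. -/
theorem clustersLaw_partialCount (K : ℕ) {q : ℕ} (B : Fin q → Set ℝ) (c : Fin q → ℕ)
    (hB : ∀ j, MeasurableSet (B j)) (hd : Pairwise fun i j => Disjoint (B i) (B j)) :
    clustersLaw r ρ {ω | ∀ j, partialCount K ω (B j) = c j}
      = ∏ j, poissonMeasure (∑ m ∈ Finset.range K, r m * (ρ m (B j)).toNNReal) {c j} := by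
  set lam : Fin q → NNReal := fun j => ∑ m ∈ Finset.range K, r m * (ρ m (B j)).toNNReal with hlam
  let V : (ℕ → ℕ × (ℕ → ℝ)) → EuclideanSpace ℝ (Fin q) :=
    fun ω => WithLp.toLp 2 fun j => (partialCount K ω (B j) : ℝ)
  have hV : Measurable V := by
    refine (WithLp.measurable_toLp 2 _).comp ?_
    refine measurable_pi_lambda _ fun j => ?_
    exact (measurable_from_nat (f := fun n : ℕ => (n : ℝ))).comp (measurable_partialCount K (hB j))
  let ν : Fin q → Measure ℝ := fun j => (poissonMeasure (lam j)).map (Nat.cast : ℕ → ℝ)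
  have : ∀ j, IsProbabilityMeasure (ν j) := fun j =>
    Measure.isProbabilityMeasure_map (Measurable.of_discrete).aemeasurable
  have key : (clustersLaw r ρ).map V = (Measure.pi ν).map (WithLp.toLp 2) := by
    have : IsProbabilityMeasure ((clustersLaw r ρ).map V) :=
      Measure.isProbabilityMeasure_map hV.aemeasurable
    have : IsProbabilityMeasure ((Measure.pi ν).map (WithLp.toLp 2)) :=
      Measure.isProbabilityMeasure_map (WithLp.measurable_toLp 2 _).aemeasurable
    refine Measure.ext_of_charFun (funext fun t => ?_)
    rw [charFun_pi, charFun_apply, integral_map hV.aemeasurable (by fun_prop)]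
    simp_rw [ν, charFun_map_cast_poissonMeasure]
    rw [← Complex.exp_sum]
    set g : ℝ → ℂ := fun y => Complex.exp ((∑ j, (B j).indicator 1 y * t j : ℝ) * Complex.I)
      with hgdef
    have hg : Measurable g := by
      have : Measurable fun y : ℝ => (∑ j, (B j).indicator 1 y * t j : ℝ) :=
        Finset.measurable_fun_sum _ fun j _ => (measurable_one.indicator (hB j)).mul_const _
      fun_prop
    have hg1 : ∀ y, ‖g y‖ ≤ 1 := fun y => by rw [hgdef, Complex.norm_exp_ofReal_mul_I]
    have e1 : ∀ ω, Complex.exp ((inner ℝ (V ω) t : ℝ) * Complex.I)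
        = ∏ m ∈ Finset.range K, ∏ i ∈ Finset.range (ω m).1, g ((ω m).2 i) := by
      intro ω
      simp_rw [hgdef, ← Complex.exp_sum, ← Finset.sum_mul, ← Complex.ofReal_sum]
      congr 3
      simp only [V, PiLp.inner_apply, partialCount, clusterCount]
      push_cast
      simp only [RCLike.inner_apply, conj_trivial, Finset.mul_sum]
      rw [Finset.sum_comm]
      refine Finset.sum_congr rfl fun m _ => ?_
      rw [Finset.sum_comm]
      refine Finset.sum_congr rfl fun i _ => Finset.sum_congr rfl fun j _ => ?_
      by_cases h : (ω m).2 i ∈ B j <;> simp [h]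
    simp_rw [e1]
    rw [integral_clustersLaw r ρ hg hg1]
    congr 1
    have e2 : ∀ m, ∫ y, g y ∂(ρ m) - 1
        = ∑ j, ((ρ m (B j)).toNNReal : ℂ) * (Complex.exp (t j * Complex.I) - 1) := by
      intro m
      -- At most one indicator is non-zero at `y`, so the exponential of the sum is linear in the
      -- indicators.
      have e3 : ∀ y, g y = 1 + ∑ j, (B j).indicator
          (fun _ => Complex.exp (t j * Complex.I) - 1) y := by
        intro y
        by_cases hy : ∃ j, y ∈ B j
        · obtain ⟨j, hj⟩ := hy
          have hne : ∀ i, i ≠ j → y ∉ B i := fun i hi h => Set.disjoint_left.1 (hd hi) h hj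
          rw [hgdef]
          simp only
          rw [Finset.sum_eq_single j (fun i _ hi => by simp [hne i hi]) (by simp),
            Finset.sum_eq_single j (fun i _ hi => by simp [hne i hi]) (by simp)]
          simp [hj]
        · push Not at hy
          simp [hgdef, hy]
      simp_rw [e3]
      rw [integral_add (integrable_const _), integral_finsetSum]
      · simp [integral_indicator_const, hB, Measure.real, ENNReal.toReal]
      · exact fun j _ => (integrable_const _).indicator (hB j)
      · exact integrable_finsetSum _ fun j _ => (integrable_const _).indicator (hB j)
    simp_rw [e2, Finset.mul_sum]
    rw [Finset.sum_comm]
    refine Finset.sum_congr rfl fun j _ => ?_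
    rw [hlam]
    push_cast
    rw [Finset.sum_mul]
    exact Finset.sum_congr rfl fun m _ => by ring
  have h1 := congrArg (fun μ => μ {WithLp.toLp 2 fun j => (c j : ℝ)}) key
  rw [Measure.map_apply hV (measurableSet_singleton _),
    Measure.map_apply (WithLp.measurable_toLp 2 _) (measurableSet_singleton _)] at h1
  have e4 : V ⁻¹' {WithLp.toLp 2 fun j => (c j : ℝ)} = {ω | ∀ j, partialCount K ω (B j) = c j} := by
    ext ω
    simp [V, funext_iff]
  have e5 : (WithLp.toLp 2 : (Fin q → ℝ) → EuclideanSpace ℝ (Fin q)) ⁻¹'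
      {WithLp.toLp 2 fun j => (c j : ℝ)} = Set.univ.pi fun j => {(c j : ℝ)} := by
    ext x
    simp [funext_iff]
  rw [e4, e5, Measure.pi_pi] at h1
  rw [h1]
  refine Finset.prod_congr rfl fun j _ => ?_
  simp only [ν]
  rw [Measure.map_apply .of_discrete (measurableSet_singleton _)]
  congr 1
  ext n
  simp

end

/-! ### Infinitely many clusters -/

/-- Monotone integer sequences diverge or become constant. This lets events about the first `K`
counts converge pointwise as `K → ∞`. -/
theorem tendsto_natCast_ennreal_cases {a : ℕ → ℕ} (ha : Monotone a) {L : ENNReal}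
    (h : Tendsto (fun K => (a K : ENNReal)) atTop (nhds L)) :
    (Tendsto a atTop atTop ∧ L = ⊤) ∨ ∃ n : ℕ, (∀ᶠ K in atTop, a K = n) ∧ L = n := by
  rcases tendsto_atTop_of_monotone ha with h1 | ⟨l, hl⟩
  · exact Or.inl ⟨h1, tendsto_nhds_unique h (ENNReal.tendsto_nat_nhds_top.comp h1)⟩
  · refine Or.inr ⟨l, ?_, ?_⟩
    · rwa [nhds_discrete, tendsto_pure] at hl
    · refine tendsto_nhds_unique h ?_
      rw [nhds_discrete, tendsto_pure] at hl
      exact tendsto_const_nhds.congr' (hl.mono fun K hK => by simp only [hK])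

theorem eventually_eq_natCast_iff {a : ℕ → ℕ} (ha : Monotone a) {L : ENNReal}
    (h : Tendsto (fun K => (a K : ENNReal)) atTop (nhds L)) (c : ℕ) :
    (∀ᶠ K in atTop, a K = c) ↔ L = c := by
  rcases tendsto_natCast_ennreal_cases ha h with ⟨h1, rfl⟩ | ⟨n, hn, rfl⟩
  · refine iff_of_false (fun h2 => ?_) (by simp)
    obtain ⟨K, hK, hK'⟩ := (h2.and (h1.eventually_gt_atTop c)).exists
    omega
  · constructor
    · intro h2
      obtain ⟨K, hK, hK'⟩ := (h2.and hn).exists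
      rw [← hK, hK']
    · intro h2
      rw [← Nat.cast_inj.1 h2]
      exact hn

/-- The sum of the unit masses at the points of all clusters. -/
noncomputable def pointMeasure (ω : ℕ → ℕ × (ℕ → ℝ)) : Measure ℝ :=
  Measure.sum fun m => ∑ i ∈ Finset.range (ω m).1, Measure.dirac ((ω m).2 i)

theorem pointMeasure_apply (ω : ℕ → ℕ × (ℕ → ℝ)) {B : Set ℝ} (hB : MeasurableSet B) :
    pointMeasure ω B = ∑' m, (clusterCount (ω m) B : ENNReal) := by
  unfold pointMeasure clusterCount
  rw [Measure.sum_apply _ hB]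
  congr with m
  rw [Measure.finsetSum_apply]
  push_cast
  refine Finset.sum_congr rfl fun i _ => ?_
  rw [Measure.dirac_apply' _ hB]
  by_cases h : (ω m).2 i ∈ B <;> simp [h]

theorem measurable_pointMeasure_apply {B : Set ℝ} (hB : MeasurableSet B) :
    Measurable fun ω => pointMeasure ω B := by
  simp_rw [pointMeasure_apply _ hB]
  refine Measurable.tsum fun m => ?_
  exact (measurable_from_nat (f := fun n : ℕ => (n : ENNReal))).comp
    ((measurable_clusterCount hB).comp (measurable_pi_apply m))

theorem monotone_partialCount (ω : ℕ → ℕ × (ℕ → ℝ)) (B : Set ℝ) :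
    Monotone fun K => partialCount K ω B := fun _ _ h =>
  Finset.sum_le_sum_of_subset (Finset.range_mono h)

theorem tendsto_partialCount (ω : ℕ → ℕ × (ℕ → ℝ)) {B : Set ℝ} (hB : MeasurableSet B) :
    Tendsto (fun K => (partialCount K ω B : ENNReal)) atTop (nhds (pointMeasure ω B)) := by
  rw [pointMeasure_apply _ hB]
  unfold partialCount
  push_cast
  exact ENNReal.summable.hasSum.tendsto_sum_nat

theorem pointMeasure_eq_top_or_natCast (ω : ℕ → ℕ × (ℕ → ℝ)) {B : Set ℝ} (hB : MeasurableSet B) :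
    pointMeasure ω B = ⊤ ∨ ∃ n : ℕ, pointMeasure ω B = n := by
  rcases tendsto_natCast_ennreal_cases (monotone_partialCount ω B) (tendsto_partialCount ω hB)
    with h | ⟨n, -, h⟩
  · exact Or.inl h.2
  · exact Or.inr ⟨n, h⟩

section

variable (r : ℕ → NNReal) (ρ : ℕ → Measure ℝ) [∀ m, IsProbabilityMeasure (ρ m)]

/-- Let the number of clusters grow: the probabilities converge because the indicators do, and the
Poisson weights because they are continuous in the rate. -/
theorem clustersLaw_pointMeasure {ν : Measure ℝ} (hν : ν = Measure.sum fun m => r m • ρ m) {q : ℕ}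
    (B : Fin q → Set ℝ) (c : Fin q → ℕ) (hB : ∀ j, MeasurableSet (B j))
    (hd : Pairwise fun i j => Disjoint (B i) (B j)) (hfin : ∀ j, ν (B j) ≠ ⊤) :
    clustersLaw r ρ {ω | ∀ j, pointMeasure ω (B j) = c j}
      = ∏ j, poissonMeasure (ν (B j)).toNNReal {c j} := by
  have h1 : Tendsto (fun K => clustersLaw r ρ {ω | ∀ j, partialCount K ω (B j) = c j}) atTop
      (nhds (clustersLaw r ρ {ω | ∀ j, pointMeasure ω (B j) = c j})) := by
    refine tendsto_measure_of_ae_tendsto_indicator_of_isFiniteMeasure atTop ?_ ?_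
      (ae_of_all _ fun ω => ?_)
    · simp only [Set.ofPred_forall]
      exact MeasurableSet.iInter fun j =>
        measurable_pointMeasure_apply (hB j) (measurableSet_singleton _)
    · intro K
      simp only [Set.ofPred_forall]
      exact MeasurableSet.iInter fun j =>
        measurable_partialCount K (hB j) (measurableSet_singleton _)
    · have key := fun j => eventually_eq_natCast_iff (monotone_partialCount ω (B j))
        (tendsto_partialCount ω (hB j)) (c j)
      by_cases h : ∀ j, pointMeasure ω (B j) = c j
      · have : ∀ᶠ K in atTop, ∀ j, partialCount K ω (B j) = c j :=
          eventually_all.2 fun j => (key j).2 (h j)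
        exact this.mono fun K hK => iff_of_true hK h
      · obtain ⟨j, hj⟩ := not_forall.1 h
        rcases tendsto_natCast_ennreal_cases (monotone_partialCount ω (B j))
          (tendsto_partialCount ω (hB j)) with h2 | ⟨n, hn, hn'⟩
        · filter_upwards [h2.1.eventually_gt_atTop (c j)] with K hK
          exact iff_of_false (fun h3 => (h3 j ▸ hK).false) h
        · filter_upwards [hn] with K hK
          refine iff_of_false (fun h3 => hj ?_) h
          rw [hn', ← hK, h3 j]
  have h2 : Tendsto (fun K => clustersLaw r ρ {ω | ∀ j, partialCount K ω (B j) = c j}) atTop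
      (nhds (∏ j, poissonMeasure (ν (B j)).toNNReal {c j})) := by
    simp_rw [clustersLaw_partialCount r ρ _ B c hB hd, poissonMeasure_singleton]
    refine ENNReal.tendsto_finsetProd_of_ne_top _ (fun j _ => ?_) fun j _ => ENNReal.ofReal_ne_top
    refine ENNReal.tendsto_ofReal ?_
    have h3 : Tendsto (fun K => (∑ m ∈ Finset.range K, r m * (ρ m (B j)).toNNReal)) atTop
        (nhds (ν (B j)).toNNReal) := by
      have h4 : ν (B j) = ∑' m, ((r m * (ρ m (B j)).toNNReal : NNReal) : ENNReal) := by
        rw [hν, Measure.sum_apply _ (hB j)]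
        congr with m
        rw [Measure.smul_apply, ENNReal.coe_mul, ENNReal.coe_toNNReal (measure_ne_top _ _)]
        rfl
      have h5 := hfin j
      rw [h4] at h5 ⊢
      have h6 := ENNReal.tsum_coe_ne_top_iff_summable.1 h5
      rw [← ENNReal.coe_tsum h6, ENNReal.toNNReal_coe]
      exact h6.hasSum.tendsto_sum_nat
    have h7 : Continuous fun x : NNReal =>
        Real.exp (-(x : ℝ)) * (x : ℝ) ^ (c j) / ((c j).factorial : ℝ) := by fun_prop
    exact (h7.tendsto _).comp h3
  exact tendsto_nhds_unique h1 h2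

/-- The Poisson weights of the finite counts already add up to one. -/
theorem ae_pointMeasure_ne_top {ν : Measure ℝ} (hν : ν = Measure.sum fun m => r m • ρ m)
    {B : Set ℝ} (hB : MeasurableSet B) (hfin : ν B ≠ ⊤) :
    ∀ᵐ ω ∂(clustersLaw r ρ), pointMeasure ω B ≠ ⊤ := by
  have h : ∀ c : ℕ, clustersLaw r ρ {ω | pointMeasure ω B = c}
      = poissonMeasure (ν B).toNNReal {c} := by
    intro c
    have := clustersLaw_pointMeasure r ρ hν (q := 1) (fun _ => B) (fun _ => c) (fun _ => hB)
      (fun i j hij => absurd (Subsingleton.elim i j) hij) fun _ => hfin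
    simpa using this
  have hm : ∀ c : ℕ, MeasurableSet {ω | pointMeasure ω B = c} := fun c =>
    measurable_pointMeasure_apply hB (measurableSet_singleton _)
  have h1 : clustersLaw r ρ (⋃ c : ℕ, {ω | pointMeasure ω B = c}) = 1 := by
    rw [measure_iUnion _ hm]
    · simp_rw [h]
      rw [← measure_univ (μ := poissonMeasure (ν B).toNNReal), ← Set.iUnion_of_singleton ℕ,
        measure_iUnion _ fun _ => measurableSet_singleton _]
      intro i j hij
      simpa using hij
    · intro i j hij
      refine Set.disjoint_left.2 fun ω h1 h2 => hij ?_
      exact Nat.cast_inj.1 (h1.symm.trans h2)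
  rw [← prob_compl_eq_zero_iff (MeasurableSet.iUnion hm)] at h1
  refine measure_mono_null ?_ h1
  intro ω hω hω'
  obtain ⟨c, hc⟩ := Set.mem_iUnion.1 hω'
  simp only [Set.mem_ofPred_eq] at hc
  exact hω (by simp [hc])

/-- A total of `c` points forces at most `c` points in every `Iic n`, and the probability of that
vanishes as the Poisson rate diverges. -/
theorem ae_pointMeasure_univ_eq_top {ν : Measure ℝ} (hν : ν = Measure.sum fun m => r m • ρ m)
    (hfin : ∀ x : ℝ, ν (Set.Iic x) ≠ ⊤) (htop : ν Set.univ = ⊤) :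
    ∀ᵐ ω ∂(clustersLaw r ρ), pointMeasure ω Set.univ = ⊤ := by
  have h : ∀ (x : ℝ) (c : ℕ), clustersLaw r ρ {ω | pointMeasure ω (Set.Iic x) = c}
      = poissonMeasure (ν (Set.Iic x)).toNNReal {c} := by
    intro x c
    have := clustersLaw_pointMeasure r ρ hν (q := 1) (fun _ => Set.Iic x) (fun _ => c)
      (fun _ => measurableSet_Iic)
      (fun i j hij => absurd (Subsingleton.elim i j) hij) fun _ => hfin x
    simpa using this
  have hlim : Tendsto (fun n : ℕ => ((ν (Set.Iic (n : ℝ))).toNNReal : ℝ)) atTop atTop := by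
    have h1 : Tendsto (fun n : ℕ => ν (Set.Iic (n : ℝ))) atTop (nhds ⊤) := by
      rw [← htop]
      have hU : (⋃ n : ℕ, Set.Iic (n : ℝ)) = Set.univ := by
        refine Set.eq_univ_of_forall fun x => ?_
        obtain ⟨n, hn⟩ := exists_nat_ge x
        exact Set.mem_iUnion.2 ⟨n, hn⟩
      rw [← hU]
      refine tendsto_measure_iUnion_atTop fun m n hmn => Set.Iic_subset_Iic.2 ?_
      exact_mod_cast hmn
    refine tendsto_atTop.2 fun b => ?_
    filter_upwards [h1.eventually_const_lt (ENNReal.coe_lt_top (r := b.toNNReal))] with n hn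
    have h2 : b.toNNReal ≤ (ν (Set.Iic (n : ℝ))).toNNReal := by
      rw [← ENNReal.coe_le_coe, ENNReal.coe_toNNReal (hfin _)]
      exact hn.le
    exact (Real.le_coe_toNNReal b).trans (by exact_mod_cast h2)
  have hz : ∀ c : ℕ, clustersLaw r ρ {ω | pointMeasure ω Set.univ = c} = 0 := by
    intro c
    have hb : ∀ n : ℕ, clustersLaw r ρ {ω | pointMeasure ω Set.univ = c}
        ≤ ∑ k ∈ Finset.range (c + 1), poissonMeasure (ν (Set.Iic (n : ℝ))).toNNReal {k} := by
      intro n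
      calc clustersLaw r ρ {ω | pointMeasure ω Set.univ = c}
          ≤ clustersLaw r ρ (⋃ k ∈ Finset.range (c + 1),
              {ω | pointMeasure ω (Set.Iic (n : ℝ)) = k}) := by
            refine measure_mono fun ω hω => ?_
            have hle : pointMeasure ω (Set.Iic (n : ℝ)) ≤ c :=
              (measure_mono (Set.subset_univ _)).trans (le_of_eq hω)
            rcases pointMeasure_eq_top_or_natCast ω (measurableSet_Iic (a := (n : ℝ)))
              with h1 | ⟨k, hk⟩
            · rw [h1] at hle
              simp at hle
            · rw [hk, Nat.cast_le] at hle
              simp only [Set.mem_iUnion, Finset.mem_range]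
              exact ⟨k, by omega, hk⟩
        _ ≤ _ := (measure_biUnion_finset_le _ _).trans (by simp_rw [h]; rfl)
    have ht : Tendsto (fun n : ℕ => ∑ k ∈ Finset.range (c + 1),
        poissonMeasure (ν (Set.Iic (n : ℝ))).toNNReal {k}) atTop (nhds 0) := by
      have h0 : (0 : ENNReal) = ∑ k ∈ Finset.range (c + 1), 0 := by simp
      rw [h0]
      refine tendsto_finsetSum _ fun k _ => ?_
      simp_rw [poissonMeasure_singleton]
      have h3 := ((Real.tendsto_pow_mul_exp_neg_atTop_nhds_zero k).comp hlim).div_const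
        (k.factorial : ℝ)
      have h4 := ENNReal.tendsto_ofReal h3
      simp only [zero_div, ENNReal.ofReal_zero] at h4
      refine h4.congr fun n => ?_
      simp only [Function.comp]
      rw [mul_comm]
    exact le_antisymm (ge_of_tendsto' ht hb) zero_le
  have hz' : ∀ᵐ ω ∂(clustersLaw r ρ), ∀ c : ℕ, pointMeasure ω Set.univ ≠ c :=
    ae_all_iff.2 fun c => by
      have := hz c
      rw [ae_iff]
      simpa using this
  filter_upwards [hz'] with ω hω
  rcases pointMeasure_eq_top_or_natCast ω MeasurableSet.univ with h1 | ⟨n, hn⟩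
  · exact h1
  · exact absurd hn (hω n)

end

/-! ### Enumerating the points in increasing order -/

/-- The points of `ω` can be arranged in an increasing sequence. -/
def IsOrderable (ω : ℕ → ℕ × (ℕ → ℝ)) : Prop :=
  (∀ n : ℕ, pointMeasure ω (Set.Iic n) ≠ ⊤) ∧ pointMeasure ω Set.univ = ⊤

theorem measurableSet_isOrderable : MeasurableSet {ω | IsOrderable ω} := by
  have h : ∀ (B : Set ℝ), MeasurableSet B → MeasurableSet {ω | pointMeasure ω B = ⊤} :=
    fun B hB => measurable_pointMeasure_apply hB (measurableSet_singleton _)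
  unfold IsOrderable
  rw [Set.ofPred_and, Set.ofPred_forall]
  exact (MeasurableSet.iInter fun n => (h _ measurableSet_Iic).compl).inter (h _ .univ)

open Classical in
/-- The points of `ω` in increasing order. -/
noncomputable def orderedPoints (ω : ℕ → ℕ × (ℕ → ℝ)) (k : ℕ) : ℝ :=
  if IsOrderable ω then sInf {x : ℝ | (k : ENNReal) < pointMeasure ω (Set.Iic x)} else 0

theorem IsOrderable.measure_Iic_ne_top {ω : ℕ → ℕ × (ℕ → ℝ)} (h : IsOrderable ω) (x : ℝ) :
    pointMeasure ω (Set.Iic x) ≠ ⊤ := by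
  obtain ⟨n, hn⟩ := exists_nat_ge x
  exact ((measure_mono (Set.Iic_subset_Iic.2 hn)).trans_lt (h.1 n).lt_top).ne

theorem IsOrderable.exists_lt {ω : ℕ → ℕ × (ℕ → ℝ)} (h : IsOrderable ω) (k : ℕ) :
    ∃ x : ℝ, (k : ENNReal) < pointMeasure ω (Set.Iic x) := by
  have h1 : Tendsto (fun x : ℝ => pointMeasure ω (Set.Iic x)) atTop (nhds ⊤) := by
    rw [← h.2]
    exact tendsto_measure_Iic_atTop _
  exact (h1.eventually_const_lt (ENNReal.natCast_lt_top k)).exists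

/-- The counts on `Iic (-n)` are integers tending to zero. The result bounds the infima in
`orderedPoints` from below. -/
theorem IsOrderable.exists_eq_zero {ω : ℕ → ℕ × (ℕ → ℝ)} (h : IsOrderable ω) :
    ∃ x : ℝ, pointMeasure ω (Set.Iic x) = 0 := by
  have h1 : Tendsto (fun n : ℕ => pointMeasure ω (Set.Iic (-(n : ℝ)))) atTop (nhds 0) := by
    have hI : (⋂ n : ℕ, Set.Iic (-(n : ℝ))) = ∅ := by
      refine Set.eq_empty_of_forall_notMem fun x hx => ?_
      obtain ⟨n, hn⟩ := exists_nat_gt (-x)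
      have := Set.mem_iInter.1 hx n
      simp only [Set.mem_Iic] at this
      linarith
    rw [← measure_empty (μ := pointMeasure ω), ← hI]
    refine tendsto_measure_iInter_atTop (fun n => measurableSet_Iic.nullMeasurableSet)
      (fun m n hmn => Set.Iic_subset_Iic.2 ?_) ⟨0, h.measure_Iic_ne_top _⟩
    simpa using hmn
  obtain ⟨n, hn⟩ := (h1.eventually_lt_const (zero_lt_one (α := ENNReal))).exists
  refine ⟨-(n : ℝ), ?_⟩
  rcases pointMeasure_eq_top_or_natCast ω (measurableSet_Iic (a := -(n : ℝ))) with h2 | ⟨m, hm⟩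
  · exact absurd h2 (h.measure_Iic_ne_top _)
  · rw [hm] at hn ⊢
    have : m < 1 := by exact_mod_cast hn
    simp [Nat.lt_one_iff.1 this]

/-- `orderedPoints` is the generalised inverse of the counting function, whose right continuity
makes the infimum attained. -/
theorem IsOrderable.orderedPoints_le_iff {ω : ℕ → ℕ × (ℕ → ℝ)} (h : IsOrderable ω) (k : ℕ)
    (x : ℝ) : orderedPoints ω k ≤ x ↔ (k : ENNReal) < pointMeasure ω (Set.Iic x) := by
  unfold orderedPoints
  rw [if_pos h]
  set S := {x : ℝ | (k : ENNReal) < pointMeasure ω (Set.Iic x)} with hS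
  have hbdd : BddBelow S := by
    obtain ⟨y, hy⟩ := h.exists_eq_zero
    refine ⟨y, fun z hz => le_of_not_gt fun hzy => ?_⟩
    have : pointMeasure ω (Set.Iic z) ≤ 0 :=
      (measure_mono (Set.Iic_subset_Iic.2 hzy.le)).trans hy.le
    exact not_lt_of_ge (this.trans zero_le) hz
  refine ⟨fun hx => ?_, fun hx => csInf_le hbdd hx⟩
  have h1 : Tendsto (fun n : ℕ => pointMeasure ω (Set.Iic (x + 1 / ((n : ℝ) + 1)))) atTop
      (nhds (pointMeasure ω (Set.Iic x))) := by
    have hI : (⋂ n : ℕ, Set.Iic (x + 1 / ((n : ℝ) + 1))) = Set.Iic x := by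
      ext y
      simp only [Set.mem_iInter, Set.mem_Iic]
      refine ⟨fun hy => ?_, fun hy n => hy.trans (by
        have : (0 : ℝ) < 1 / ((n : ℝ) + 1) := Nat.one_div_pos_of_nat
        linarith)⟩
      refine le_of_forall_pos_lt_add fun ε hε => ?_
      obtain ⟨n, hn⟩ := exists_nat_one_div_lt hε
      linarith [hy n]
    rw [← hI]
    refine tendsto_measure_iInter_atTop (fun n => measurableSet_Iic.nullMeasurableSet)
      (fun m n hmn => Set.Iic_subset_Iic.2 ?_) ⟨0, h.measure_Iic_ne_top _⟩
    have := Nat.one_div_le_one_div (α := ℝ) hmn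
    linarith
  -- Counts being integers, `k <` can be replaced by `k + 1 ≤`, which survives the limit from the
  -- right.
  have h2 : ((k + 1 : ℕ) : ENNReal) ≤ pointMeasure ω (Set.Iic x) := by
    refine ge_of_tendsto' h1 fun n => ?_
    have hpos : (0 : ℝ) < 1 / ((n : ℝ) + 1) := Nat.one_div_pos_of_nat
    obtain ⟨y, hy, hy'⟩ := exists_lt_of_csInf_lt (h.exists_lt k) (show sInf S < x + 1 / ((n : ℝ) + 1)
      by linarith)
    have h3 : (k : ENNReal) < pointMeasure ω (Set.Iic (x + 1 / ((n : ℝ) + 1))) :=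
      lt_of_lt_of_le hy (measure_mono (Set.Iic_subset_Iic.2 hy'.le))
    rcases pointMeasure_eq_top_or_natCast ω
      (measurableSet_Iic (a := x + 1 / ((n : ℝ) + 1))) with h4 | ⟨m, hm⟩
    · rw [h4]
      exact le_top
    · rw [hm] at h3 ⊢
      exact_mod_cast h3
  exact lt_of_lt_of_le (by exact_mod_cast Nat.lt_succ_self k) h2

theorem IsOrderable.monotone_orderedPoints {ω : ℕ → ℕ × (ℕ → ℝ)} (h : IsOrderable ω) :
    Monotone (orderedPoints ω) := by
  intro j k hjk
  rw [h.orderedPoints_le_iff]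
  refine lt_of_le_of_lt ?_ ((h.orderedPoints_le_iff k _).1 le_rfl)
  exact_mod_cast hjk

/-- The counting measure of the enumerated points and `pointMeasure ω` agree, with finite values, on
the half-lines `Iic x`, a generating π-system. -/
theorem IsOrderable.encard_orderedPoints {ω : ℕ → ℕ × (ℕ → ℝ)} (h : IsOrderable ω) {B : Set ℝ}
    (hB : MeasurableSet B) :
    ({k | orderedPoints ω k ∈ B}.encard : ENNReal) = pointMeasure ω B := by
  have hm : Measurable (orderedPoints ω) := measurable_from_nat
  have key : Measure.count.map (orderedPoints ω) = pointMeasure ω := by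
    have hIic : ∀ x : ℝ, Measure.count.map (orderedPoints ω) (Set.Iic x)
        = pointMeasure ω (Set.Iic x) := by
      intro x
      rw [Measure.map_apply hm measurableSet_Iic]
      have : orderedPoints ω ⁻¹' Set.Iic x
          = {k : ℕ | (k : ENNReal) < pointMeasure ω (Set.Iic x)} := by
        ext k
        exact h.orderedPoints_le_iff k x
      rw [this]
      rcases pointMeasure_eq_top_or_natCast ω (measurableSet_Iic (a := x)) with h1 | ⟨m, hm⟩
      · exact absurd h1 (h.measure_Iic_ne_top x)
      · rw [hm]
        have h2 : {k : ℕ | (k : ENNReal) < (m : ENNReal)} = (Finset.range m : Set ℕ) := by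
          ext k
          simp
        rw [h2, Measure.count_apply_finset]
        simp
    refine Measure.ext_of_generateFrom_of_iUnion (Set.range Set.Iic) (fun n : ℕ => Set.Iic (n : ℝ))
      (borel_eq_generateFrom_Iic ℝ ▸ BorelSpace.measurable_eq) isPiSystem_Iic ?_ ?_ ?_ ?_
    · refine Set.eq_univ_of_forall fun x => ?_
      obtain ⟨n, hn⟩ := exists_nat_ge x
      exact Set.mem_iUnion.2 ⟨n, hn⟩
    · exact fun n => ⟨_, rfl⟩
    · intro n
      rw [hIic]
      exact h.measure_Iic_ne_top _
    · rintro _ ⟨x, rfl⟩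
      exact hIic x
  rw [← key, Measure.map_apply hm hB, Measure.count_apply (hm hB)]
  rfl

theorem measurable_orderedPoints : Measurable orderedPoints := by
  refine measurable_pi_lambda _ fun k => measurable_of_Iic fun x => ?_
  have : (fun ω => orderedPoints ω k) ⁻¹' Set.Iic x
      = ({ω | IsOrderable ω} ∩ {ω | (k : ENNReal) < pointMeasure ω (Set.Iic x)})
        ∪ ({ω | IsOrderable ω}ᶜ ∩ {_ω | 0 ≤ x}) := by
    ext ω
    by_cases h : IsOrderable ω
    · simp [h, h.orderedPoints_le_iff]
    · simp [h, orderedPoints]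
  rw [this]
  refine (measurableSet_isOrderable.inter ?_).union
    (measurableSet_isOrderable.compl.inter (MeasurableSet.const _))
  exact measurable_pointMeasure_apply measurableSet_Iic measurableSet_Ioi

/-! ### Measurability of cardinalities -/

theorem measurableSet_le_encard {Ω α : Type*} [MeasurableSpace Ω] [Countable α] {f : Ω → Set α}
    (hf : ∀ a, MeasurableSet {ω | a ∈ f ω}) (n : ℕ) :
    MeasurableSet {ω | (n : ℕ∞) ≤ (f ω).encard} := by
  have h : {ω | (n : ℕ∞) ≤ (f ω).encard}
      = ⋃ (F : Finset α) (_ : F.card = n), ⋂ a ∈ F, {ω | a ∈ f ω} := by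
    ext ω
    simp only [Set.mem_ofPred_eq, Set.mem_iUnion, Set.mem_iInter, exists_prop]
    constructor
    · intro h
      obtain ⟨t, ht, htn⟩ := Set.exists_subset_encard_eq h
      have hfin : t.Finite := Set.finite_of_encard_eq_coe htn
      refine ⟨hfin.toFinset, ?_, fun a ha => ht (hfin.mem_toFinset.1 ha)⟩
      rw [hfin.encard_eq_coe_toFinset_card] at htn
      exact_mod_cast htn
    · rintro ⟨F, rfl, hF⟩
      rw [← Set.encard_coe_eq_coe_finsetCard]
      exact Set.encard_le_encard hF
  rw [h]
  exact MeasurableSet.iUnion fun F => MeasurableSet.iUnion fun _ =>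
    Finset.measurableSet_biInter _ fun a _ => hf a

theorem measurableSet_lt_encard {Ω α : Type*} [MeasurableSpace Ω] [Countable α] {f : Ω → Set α}
    (hf : ∀ a, MeasurableSet {ω | a ∈ f ω}) (n : ℕ) :
    MeasurableSet {ω | (n : ℕ∞) < (f ω).encard} := by
  have h : {ω | (n : ℕ∞) < (f ω).encard} = {ω | ((n + 1 : ℕ) : ℕ∞) ≤ (f ω).encard} := by
    ext ω
    simp only [Set.mem_ofPred_eq, Nat.cast_add, Nat.cast_one]
    exact (ENat.add_one_le_iff (ENat.natCast_ne_top n)).symm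
  rw [h]
  exact measurableSet_le_encard hf _

theorem measurableSet_encard_eq {Ω α : Type*} [MeasurableSpace Ω] [Countable α] {f : Ω → Set α}
    (hf : ∀ a, MeasurableSet {ω | a ∈ f ω}) (n : ℕ) :
    MeasurableSet {ω | (f ω).encard = n} := by
  have h : {ω | (f ω).encard = n}
      = {ω | (n : ℕ∞) ≤ (f ω).encard} \ {ω | (n : ℕ∞) < (f ω).encard} := by
    ext ω
    simp only [Set.mem_sdiff, Set.mem_ofPred_eq, not_lt]
    exact ⟨fun h => ⟨h.ge, h.le⟩, fun h => le_antisymm h.2 h.1⟩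
  rw [h]
  exact (measurableSet_le_encard hf n).diff (measurableSet_lt_encard hf n)

/-! ### Existence of the ordered Poisson process -/

theorem exists_smul_isProbabilityMeasure (ν : Measure ℝ) [IsFiniteMeasure ν] :
    ∃ (r : NNReal) (ρ : Measure ℝ), IsProbabilityMeasure ρ ∧ ν = r • ρ := by
  by_cases h : ν = 0
  · exact ⟨0, Measure.dirac 0, inferInstance, by simp [h]⟩
  · have h0 : ν Set.univ ≠ 0 := by simpa using h
    refine ⟨(ν Set.univ).toNNReal, (ν Set.univ)⁻¹ • ν, ⟨?_⟩, ?_⟩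
    · rw [Measure.smul_apply, smul_eq_mul, ENNReal.inv_mul_cancel h0 (measure_ne_top _ _)]
    · ext s hs
      rw [Measure.smul_apply, Measure.smul_apply, ENNReal.smul_def, smul_eq_mul, smul_eq_mul,
        ENNReal.coe_toNNReal (measure_ne_top _ _), ← mul_assoc,
        ENNReal.mul_inv_cancel h0 (measure_ne_top _ _), one_mul]

/-- Each finite piece of `ν` contributes one cluster. Finite mass on left half-lines permits an
increasing enumeration, and infinite total mass makes it use every index. -/
theorem exists_isOrderedPoissonProcess (ν : Measure ℝ) [SFinite ν]
    (hfin : ∀ x : ℝ, ν (Set.Iic x) ≠ ⊤) (htop : ν Set.univ = ⊤) :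
    ∃ μ : Measure (ℕ → ℝ), IsProbabilityMeasure μ ∧ IsOrderedPoissonProcess μ ν id := by
  choose r ρ hρ hrρ using fun m => exists_smul_isProbabilityMeasure (sfiniteSeq ν m)
  have hν : ν = Measure.sum fun m => r m • ρ m := by
    conv_lhs => rw [← sum_sfiniteSeq ν]
    congr with m : 1
    exact hrρ m
  have hord : ∀ᵐ ω ∂(clustersLaw r ρ), IsOrderable ω := by
    have h1 : ∀ᵐ ω ∂(clustersLaw r ρ), ∀ n : ℕ, pointMeasure ω (Set.Iic n) ≠ ⊤ :=
      ae_all_iff.2 fun n => ae_pointMeasure_ne_top r ρ hν measurableSet_Iic (hfin n)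
    filter_upwards [h1, ae_pointMeasure_univ_eq_top r ρ hν hfin htop] with ω h2 h3
    exact ⟨h2, h3⟩
  have hm := measurable_orderedPoints
  refine ⟨(clustersLaw r ρ).map orderedPoints, Measure.isProbabilityMeasure_map hm.aemeasurable,
    measurable_id, ?_, ?_⟩
  · have hmon : MeasurableSet {p : ℕ → ℝ | Monotone p} := by
      simp only [Monotone, Set.ofPred_forall]
      exact MeasurableSet.iInter fun i => MeasurableSet.iInter fun j => MeasurableSet.iInter fun _ =>
        measurableSet_le (measurable_pi_apply i) (measurable_pi_apply j)
    exact (ae_map_iff hm.aemeasurable hmon).2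
      (hord.mono fun ω hω => hω.monotone_orderedPoints)
  · intro q B c hB hd hf
    rw [← clustersLaw_pointMeasure r ρ hν B c hB hd hf, Measure.map_apply hm]
    · refine measure_congr ?_
      filter_upwards [hord] with ω hω
      refine propext (forall_congr' fun j => ?_)
      rw [← hω.encard_orderedPoints (hB j), ← ENat.toENNReal_coe, ENat.toENNReal_inj]
      rfl
    · rw [Set.ofPred_forall]
      exact MeasurableSet.iInter fun j =>
        measurableSet_encard_eq (f := fun p : ℕ → ℝ => {k | p k ∈ B j})
          (fun k => measurable_pi_apply (X := fun _ : ℕ => ℝ) k (hB j)) (c j)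

/-! ### Revealing some coordinates of a product measure -/

section Resampling

variable {ι α : Type*} [MeasurableSpace α]

open Classical in
theorem measurePreserving_piecewise_infinitePi (μ : ι → Measure α)
    [∀ i, IsProbabilityMeasure (μ i)] (S : Set ι) :
    MeasurePreserving (fun p : (ι → α) × (ι → α) => S.piecewise p.1 p.2)
      ((Measure.infinitePi μ).prod (Measure.infinitePi μ)) (Measure.infinitePi μ) := by
  have hm : Measurable fun p : (ι → α) × (ι → α) => S.piecewise p.1 p.2 := by
    refine measurable_pi_lambda _ fun i => ?_
    by_cases h : i ∈ S
    · simp only [Set.piecewise_eq_of_mem _ _ _ h]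
      fun_prop
    · simp only [Set.piecewise_eq_of_notMem _ _ _ h]
      fun_prop
  refine ⟨hm, Measure.eq_infinitePi μ fun s t ht => ?_⟩
  rw [Measure.map_apply hm (.pi s.countable_toSet fun i _ => ht i)]
  have h : (fun p : (ι → α) × (ι → α) => S.piecewise p.1 p.2) ⁻¹' Set.pi s t
      = (Set.pi (s.filter (· ∈ S)) t) ×ˢ (Set.pi (s.filter (· ∉ S)) t) := by
    ext p
    simp only [Set.mem_preimage, Set.mem_pi, Set.mem_prod, Finset.coe_filter, Set.mem_ofPred_eq,
      Finset.mem_coe]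
    constructor
    · intro h
      refine ⟨fun i hi => ?_, fun i hi => ?_⟩
      · simpa [hi.2] using h i hi.1
      · simpa [hi.2] using h i hi.1
    · intro h i hi
      by_cases hS : i ∈ S
      · simpa [hS] using h.1 i ⟨hi, hS⟩
      · simpa [hS] using h.2 i ⟨hi, hS⟩
  rw [h, Measure.prod_prod, Measure.infinitePi_pi _ fun i _ => ht i,
    Measure.infinitePi_pi _ fun i _ => ht i, Finset.prod_filter_mul_prod_filter_not]

open Classical in
theorem measurePreserving_update_infinitePi (μ : ι → Measure α)
    [∀ i, IsProbabilityMeasure (μ i)] (i : ι) :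
    MeasurePreserving (fun p : α × (ι → α) => Function.update p.2 i p.1)
      ((μ i).prod (Measure.infinitePi μ)) (Measure.infinitePi μ) := by
  have hm : Measurable fun p : α × (ι → α) => Function.update p.2 i p.1 := by
    refine measurable_pi_lambda _ fun j => ?_
    by_cases h : j = i
    · subst h
      simpa using measurable_fst
    · simp only [Function.update_of_ne h]
      fun_prop
  have h1 := (measurePreserving_eval_infinitePi μ i).prod
    (MeasurePreserving.id (Measure.infinitePi μ))
  refine ⟨hm, ?_⟩
  rw [← h1.map_eq, Measure.map_map hm h1.measurable]
  refine Eq.trans ?_ (measurePreserving_piecewise_infinitePi μ {i}).map_eq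
  congr 1
  ext p j
  by_cases h : j = i
  · subst h
    simp
  · simp [h]

theorem measurePreserving_comp_infinitePi {κ : Type*} (μ : Measure α) [IsProbabilityMeasure μ]
    {f : κ → ι} (hf : Function.Injective f) :
    MeasurePreserving (fun x : ι → α => fun k => x (f k)) (Measure.infinitePi fun _ => μ)
      (Measure.infinitePi fun _ => μ) := by
  have hind : iIndepFun (fun (k : κ) (x : ι → α) => x (f k)) (Measure.infinitePi fun _ : ι => μ) :=
    (iIndepFun_infinitePi (P := fun _ : ι => μ) (X := fun _ => id) fun _ => measurable_id).precomp
      hf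
  have hm : Measurable (fun x : ι → α => fun k => x (f k)) :=
    measurable_pi_lambda _ fun k => measurable_pi_apply _
  refine ⟨hm, ?_⟩
  rw [hind.map_fun_eq_infinitePi_map fun k => measurable_pi_apply _]
  congr with k : 1
  exact (measurePreserving_eval_infinitePi (fun _ : ι => μ) (f k)).map_eq

/-- Reveal the coordinates in `S` and resample the others independently: `B x` depends on `x` only
through `S`, while membership in it is decided off `S`. Applied to the graph, with `S` the pairs
that contain the explored vertex. -/
theorem infinitePi_le_lintegral_piecewise (μ : ι → Measure α) [∀ i, IsProbabilityMeasure (μ i)]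
    (S : Set ι) {A : Set (ι → α)} (hA : MeasurableSet A) {B : (ι → α) → Set (ι → α)}
    (h : ∀ x, x ∈ A → x ∈ B x)
    (hB : ∀ x x' y, (∀ i ∈ S, x i = x' i) → (∀ i ∉ S, x i = y i) → x ∈ B x → y ∈ B x') :
    Measure.infinitePi μ A ≤ ∫⁻ x, Measure.infinitePi μ (B x) ∂(Measure.infinitePi μ) := by
  classical
  have hp := measurePreserving_piecewise_infinitePi μ S
  rw [← hp.measure_preimage hA.nullMeasurableSet, Measure.prod_apply (hp.measurable hA)]
  refine lintegral_mono fun x => measure_mono fun y hy => ?_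
  refine hB _ x y (fun i hi => ?_) (fun i hi => ?_) (h _ hy)
  · simp [hi]
  · simp [hi]

/-- The opposite inequality for a single revealed coordinate, applied to the offspring of the
explored particle. -/
theorem lintegral_update_le_infinitePi (μ : ι → Measure α) [∀ i, IsProbabilityMeasure (μ i)]
    (i : ι) {A : Set (ι → α)} (hA : MeasurableSet A) {B : α → Set (ι → α)}
    (h : ∀ x, x ∈ B (x i) → x ∈ A)
    (hB : ∀ a x y, (∀ j, j ≠ i → x j = y j) → x ∈ B a → y ∈ B a) :
    ∫⁻ a, Measure.infinitePi μ (B a) ∂(μ i) ≤ Measure.infinitePi μ A := by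
  classical
  have hp := measurePreserving_update_infinitePi μ i
  rw [← hp.measure_preimage hA.nullMeasurableSet, Measure.prod_apply (hp.measurable hA)]
  refine lintegral_mono fun a => measure_mono fun y hy => ?_
  refine h _ ?_
  simp only [Function.update_self]
  exact hB a y _ (fun j hj => by simp [hj]) hy

end Resampling

/-! ### Couplings from uniform variables -/

-- Disintegrate the law of `(Y', Z')` along `Y'` and realise the conditional law as a function of an
-- independent uniform variable.
open unitInterval in
theorem exists_transfer {A A' E S : Type*} [MeasurableSpace A] [MeasurableSpace A']
    [MeasurableSpace E] [MeasurableSpace S] [StandardBorelSpace S] [Nonempty S]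
    (P : Measure A) [IsProbabilityMeasure P] (P' : Measure A') [IsProbabilityMeasure P']
    {Y : A → E} (hY : Measurable Y) {Y' : A' → E} {Z' : A' → S}
    (hZ' : Measurable Z') (h : P.map Y = P'.map Y') :
    ∃ f : E → I → S, Measurable (Function.uncurry f) ∧
      (P.prod volume).map (fun p => (Y p.1, f (Y p.1) p.2)) = P'.map fun a => (Y' a, Z' a) := by
  obtain ⟨f, hf, hfκ⟩ := (condDistrib Z' Y' P').exists_measurable_map_eq_unitInterval
  refine ⟨f, hf, ?_⟩
  have hm : Measurable fun p : A × I => (Y p.1, f (Y p.1) p.2) :=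
    (hY.comp measurable_fst).prodMk
      (hf.comp ((hY.comp measurable_fst).prodMk measurable_snd))
  have hfy : ∀ y, Measurable (f y) := fun y => hf.comp measurable_prodMk_left
  rw [← compProd_map_condDistrib hZ'.aemeasurable, ← h]
  have : IsProbabilityMeasure (P.map Y) := Measure.isProbabilityMeasure_map hY.aemeasurable
  ext s hs
  rw [Measure.map_apply hm hs, Measure.prod_apply (hm hs), Measure.compProd_apply hs,
    lintegral_map (Kernel.measurable_kernel_prodMk_left hs) hY]
  refine lintegral_congr fun a => ?_
  rw [← hfκ, Measure.map_apply (hfy _) (measurable_prodMk_left hs)]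
  rfl

open unitInterval in
/-- The quantile function of a measure on the natural numbers. -/
noncomputable def natQuantile (a : Measure ℕ) (u : I) : ℕ := sInf {k | (u : ℝ) ≤ a.real (Set.Iic k)}

-- At `u = 1` the set in the infimum may be empty, so this null point is excluded.
open unitInterval in
theorem natQuantile_le_iff (a : Measure ℕ) [IsProbabilityMeasure a] {u : I} (hu : u < 1) (k : ℕ) :
    natQuantile a u ≤ k ↔ (u : ℝ) ≤ a.real (Set.Iic k) := by
  constructor
  · intro h
    have hne : {k | (u : ℝ) ≤ a.real (Set.Iic k)}.Nonempty := by
      have h1 : Tendsto (fun k : ℕ => a.real (Set.Iic k)) atTop (nhds 1) := by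
        have h2 := tendsto_measure_Iic_atTop a
        rw [measure_univ] at h2
        exact (ENNReal.tendsto_toReal ENNReal.one_ne_top).comp h2
      exact (h1.eventually_const_lt (show (u : ℝ) < 1 from hu)).exists.imp fun k hk => hk.le
    exact (Nat.sInf_mem hne).trans (measureReal_mono (Set.Iic_subset_Iic.2 h))
  · exact fun h => Nat.sInf_le h

open unitInterval in
theorem ae_lt_one_unitInterval : ∀ᵐ u : I, u < 1 := by
  have : (volume : Measure I) {1} = 0 := by simp
  filter_upwards [measure_eq_zero_iff_ae_notMem.1 this] with u hu
  exact lt_of_le_of_ne u.2.2 fun h => hu h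

open unitInterval in
theorem measurable_natQuantile (a : Measure ℕ) [IsProbabilityMeasure a] :
    Measurable (natQuantile a) := by
  refine measurable_of_Iic fun k => ?_
  have : natQuantile a ⁻¹' Set.Iic k
      = ({u : I | u < 1} ∩ {u : I | (u : ℝ) ≤ a.real (Set.Iic k)})
        ∪ ({u : I | u < 1}ᶜ ∩ natQuantile a ⁻¹' Set.Iic k) := by
    ext u
    by_cases h : u < 1
    · simp [h, natQuantile_le_iff a h]
    · simp [h]
  rw [this]
  refine (measurableSet_Iio.inter
    (measurableSet_le measurable_subtype_coe measurable_const)).union ?_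
  refine Set.Finite.measurableSet (Set.Finite.subset (Set.finite_singleton (1 : I)) ?_)
  rintro u ⟨hu, -⟩
  simp only [Set.mem_compl_iff, Set.mem_ofPred_eq, not_lt] at hu
  exact le_antisymm u.2.2 hu

open unitInterval in
theorem map_natQuantile (a : Measure ℕ) [IsProbabilityMeasure a] :
    (volume : Measure I).map (natQuantile a) = a := by
  have hm := measurable_natQuantile a
  have := Measure.isProbabilityMeasure_map (μ := (volume : Measure I)) hm.aemeasurable
  refine Measure.ext_of_Iic _ _ fun k => ?_
  rw [Measure.map_apply hm measurableSet_Iic]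
  have hk : a.real (Set.Iic k) ∈ I := ⟨measureReal_nonneg, measureReal_le_one⟩
  have : natQuantile a ⁻¹' Set.Iic k =ᵐ[volume] Set.Iic (⟨_, hk⟩ : I) := by
    filter_upwards [ae_lt_one_unitInterval] with u hu
    exact propext (natQuantile_le_iff a hu k)
  rw [measure_congr this, unitInterval.volume_Iic, ofReal_measureReal]

-- The quantile functions of the laws of `N` and `Y` at a common uniform variable are ordered. One
-- transfer completes the smaller quantile to a sample of `ρ`; a second one moves the ordered pair
-- to the given space, where `Y` plays the larger quantile.
open unitInterval in
theorem exists_monotone_coupling {A S : Type*} [MeasurableSpace A] [MeasurableSpace S]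
    [StandardBorelSpace S] [Nonempty S] (P : Measure A) [IsProbabilityMeasure P] {Y : A → ℕ}
    (hY : Measurable Y) (ρ : Measure S) [IsProbabilityMeasure ρ] {N : S → ℕ} (hN : Measurable N)
    (h : ∀ k, ρ {s | k < N s} ≤ P {a | k < Y a}) :
    ∃ f : A × I → S, Measurable f ∧ (P.prod volume).map f = ρ ∧
      ∀ᵐ p ∂(P.prod volume), N (f p) ≤ Y p.1 := by
  set a := ρ.map N with ha
  set b := P.map Y with hb
  have : IsProbabilityMeasure a := Measure.isProbabilityMeasure_map hN.aemeasurable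
  have : IsProbabilityMeasure b := Measure.isProbabilityMeasure_map hY.aemeasurable
  have hqa := measurable_natQuantile a
  have hqb := measurable_natQuantile b
  have hle : ∀ k, b.real (Set.Iic k) ≤ a.real (Set.Iic k) := by
    intro k
    have e1 : a (Set.Ioi k) ≤ b (Set.Ioi k) := by
      rw [ha, hb, Measure.map_apply hN measurableSet_Ioi, Measure.map_apply hY measurableSet_Ioi]
      exact h k
    have e2 : a.real (Set.Ioi k) ≤ b.real (Set.Ioi k) :=
      ENNReal.toReal_mono (measure_ne_top _ _) e1
    rw [← Set.compl_Iic, measureReal_compl measurableSet_Iic,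
      measureReal_compl measurableSet_Iic] at e2
    simp only [probReal_univ] at e2
    linarith
  have hq : ∀ᵐ u : I, natQuantile a u ≤ natQuantile b u := by
    filter_upwards [ae_lt_one_unitInterval] with u hu
    rw [natQuantile_le_iff a hu]
    exact ((natQuantile_le_iff b hu _).1 le_rfl).trans (hle _)
  obtain ⟨g, hg, hgl⟩ := exists_transfer (volume : Measure I) ρ hqa measurable_id
    ((map_natQuantile a).trans ha)
  have hZ : Measurable fun p : I × I => g (natQuantile a p.1) p.2 :=
    hg.comp ((hqa.comp measurable_fst).prodMk measurable_snd)
  have hgm : Measurable fun p : I × I => (natQuantile a p.1, g (natQuantile a p.1) p.2) :=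
    (hqa.comp measurable_fst).prodMk hZ
  have hY2 : Measurable fun p : I × I => natQuantile b p.1 := hqb.comp measurable_fst
  have hlaw : P.map Y = ((volume : Measure I).prod (volume : Measure I)).map
      fun p => natQuantile b p.1 := by
    have := Measure.map_map (μ := (volume : Measure I).prod (volume : Measure I)) hqb
      measurable_fst
    rw [Function.comp_def] at this
    rw [← this, Measure.map_fst_prod, measure_univ, one_smul, map_natQuantile]
  obtain ⟨f, hf, hfl⟩ := exists_transfer P _ hY hZ hlaw
  have hfm : Measurable fun p : A × I => f (Y p.1) p.2 :=
    hf.comp ((hY.comp measurable_fst).prodMk measurable_snd)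
  have hfm2 : Measurable fun p : A × I => (Y p.1, f (Y p.1) p.2) :=
    (hY.comp measurable_fst).prodMk hfm
  refine ⟨fun p => f (Y p.1) p.2, hfm, ?_, ?_⟩
  · have h1 := congrArg (fun μ => μ.map Prod.snd) hfl
    have h2 := congrArg (fun μ => μ.map Prod.snd) hgl
    rw [Measure.map_map measurable_snd hfm2, Measure.map_map measurable_snd (hY2.prodMk hZ)] at h1
    rw [Measure.map_map measurable_snd hgm,
      Measure.map_map measurable_snd (hN.prodMk measurable_id)] at h2
    refine Eq.trans h1 (Eq.trans h2 ?_)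
    exact Measure.map_id
  · have hset : MeasurableSet {q : ℕ × S | N q.2 = q.1} :=
      measurableSet_eq_fun (hN.comp measurable_snd) measurable_fst
    have hset2 : MeasurableSet {q : ℕ × S | N q.2 ≤ q.1} :=
      measurableSet_le (hN.comp measurable_snd) measurable_fst
    have h1 : ∀ᵐ q ∂(ρ.map fun s => (N s, id s)), N q.2 = q.1 :=
      (ae_map_iff (hN.prodMk measurable_id).aemeasurable hset).2 (ae_of_all _ fun s => rfl)
    rw [← hgl, ae_map_iff hgm.aemeasurable hset] at h1
    have h2 : ∀ᵐ p ∂((volume : Measure I).prod (volume : Measure I)),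
        natQuantile a p.1 ≤ natQuantile b p.1 :=
      Measure.quasiMeasurePreserving_fst.ae hq
    have h3 : ∀ᵐ q ∂(((volume : Measure I).prod (volume : Measure I)).map
        fun p => (natQuantile b p.1, g (natQuantile a p.1) p.2)), N q.2 ≤ q.1 := by
      rw [ae_map_iff (hY2.prodMk hZ).aemeasurable hset2]
      filter_upwards [h1, h2] with p h4 h5
      exact h4.trans_le h5
    -- The almost sure inequality depends on the joint law only, so it carries over.
    rw [← hfl, ae_map_iff hfm2.aemeasurable hset2] at h3
    exact h3

/-! ### Killed walks and forests -/

section Walk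

theorem position_nil (x : ℝ) (d : List ℕ → ℕ → ℝ) : position x d [] = x := by
  simp [position]

theorem position_cons (x : ℝ) (d : List ℕ → ℕ → ℝ) (i : ℕ) (u : List ℕ) :
    position x d (i :: u) = position (x + d [] i) (fun v => d (i :: v)) u := by
  simp only [position, List.length_cons, Fin.sum_univ_succ]
  simp [add_assoc]

theorem nil_mem_killedWalk {x : ℝ} {d : List ℕ → ℕ → ℝ} : [] ∈ killedWalk x d ↔ x ≤ 0 := by
  simp [killedWalk, position_nil]

theorem cons_mem_killedWalk {x : ℝ} {d : List ℕ → ℕ → ℝ} {i : ℕ} {u : List ℕ} :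
    i :: u ∈ killedWalk x d ↔
      x ≤ 0 ∧ u ∈ killedWalk (x + d [] i) (fun v => d (i :: v)) := by
  constructor
  · intro h
    refine ⟨by simpa [position_nil] using h 0 (Nat.zero_le _), fun j hj => ?_⟩
    have := h (j + 1) (by simpa using hj)
    rwa [List.take_succ_cons, position_cons] at this
  · rintro ⟨h0, h⟩ j hj
    cases j with
    | zero => simpa [position_nil] using h0
    | succ j =>
      rw [List.take_succ_cons, position_cons]
      exact h j (by simpa using hj)

theorem measurable_position (v : List ℕ) :
    Measurable fun p : ℝ × (List ℕ → ℕ → ℝ) => position p.1 p.2 v := by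
  unfold position
  refine measurable_fst.add (Finset.measurable_fun_sum _ fun i _ => ?_)
  exact (measurable_pi_apply _).comp ((measurable_pi_apply _).comp measurable_snd)

theorem measurableSet_mem_killedWalk (v : List ℕ) :
    MeasurableSet {p : ℝ × (List ℕ → ℕ → ℝ) | v ∈ killedWalk p.1 p.2} := by
  have : {p : ℝ × (List ℕ → ℕ → ℝ) | v ∈ killedWalk p.1 p.2}
      = ⋂ (i : ℕ) (_ : i ≤ v.length), {p | position p.1 p.2 (v.take i) ≤ 0} := by
    ext p
    simp [killedWalk]
  rw [this]
  exact MeasurableSet.iInter fun i => MeasurableSet.iInter fun _ =>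
    measurableSet_le (measurable_position _) measurable_const

/-- The particles of the killed branching random walks started by the particles `w ∈ A` at the
positions `z w`. -/
def forest (A : Set (List ℕ)) (z : List ℕ → ℝ) (d : List ℕ → ℕ → ℝ) : Set (List ℕ) :=
  {v | ∃ w ∈ A, ∃ u ∈ killedWalk (z w) (fun u => d (w ++ u)), v = w ++ u}

/-- The forest has more than `k` particles, or a particle located in `(-∞, l]`. -/
def forestEvent (k : ℕ) (l : ℝ) (A : Set (List ℕ)) (z : List ℕ → ℝ) :
    Set (List ℕ → ℕ → ℝ) :=
  {d | (k : ℕ∞) < (forest A z d).encard ∨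
    ∃ w ∈ A, ∃ u ∈ killedWalk (z w) (fun u => d (w ++ u)),
      position (z w) (fun u => d (w ++ u)) u ≤ l}

theorem measurableSet_forestEvent (k : ℕ) (l : ℝ) (A : Set (List ℕ)) (z : List ℕ → ℝ) :
    MeasurableSet (forestEvent k l A z) := by
  have hm : ∀ w : List ℕ, Measurable fun d : List ℕ → ℕ → ℝ => (z w, fun u => d (w ++ u)) :=
    fun w => measurable_const.prodMk (measurable_pi_lambda _ fun u => measurable_pi_apply _)
  have h1 : ∀ w u : List ℕ,
      MeasurableSet {d : List ℕ → ℕ → ℝ | u ∈ killedWalk (z w) (fun u => d (w ++ u))} :=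
    fun w u => hm w (measurableSet_mem_killedWalk u)
  have h2 : ∀ w u : List ℕ,
      MeasurableSet {d : List ℕ → ℕ → ℝ | position (z w) (fun u => d (w ++ u)) u ≤ l} :=
    fun w u => hm w (measurableSet_le (measurable_position u) measurable_const)
  have h3 : forestEvent k l A z = {d | (k : ℕ∞) < (forest A z d).encard} ∪
      ⋃ (w ∈ A) (u : List ℕ), {d | u ∈ killedWalk (z w) (fun u => d (w ++ u))} ∩
          {d | position (z w) (fun u => d (w ++ u)) u ≤ l} := by
    ext d
    simp only [forestEvent, Set.mem_ofPred_eq, Set.mem_union, Set.mem_iUnion, exists_prop,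
      Set.mem_inter_iff]
  rw [h3]
  refine (measurableSet_lt_encard (fun v => ?_) k).union ?_
  · have : {d : List ℕ → ℕ → ℝ | v ∈ forest A z d} = ⋃ (w ∈ A) (u : List ℕ) (_ : v = w ++ u),
        {d | u ∈ killedWalk (z w) (fun u => d (w ++ u))} := by
      ext d
      simp only [forest, Set.mem_ofPred_eq, Set.mem_iUnion, exists_prop]
      simp only [and_comm]
    rw [this]
    exact MeasurableSet.biUnion A.to_countable fun w _ => MeasurableSet.iUnion fun u =>
      MeasurableSet.iUnion fun _ => h1 w u
  · exact MeasurableSet.biUnion A.to_countable fun w _ => MeasurableSet.iUnion fun u =>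
      (h1 w u).inter (h2 w u)

/-- No particle in `A` is a strict ancestor of another one. -/
def IsPrefixFree (A : Set (List ℕ)) : Prop := ∀ v ∈ A, ∀ w ∈ A, v <+: w → v = w

/-- The particles of `A` except for `w`, together with those children of `w` that are not
killed when the displacements are `e` and `w` is located at `x`. -/
def replaceByChildren (A : Set (List ℕ)) (w : List ℕ) (x : ℝ) (e : ℕ → ℝ) : Set (List ℕ) :=
  A \ {w} ∪ {v | ∃ i, v = w ++ [i] ∧ x + e i ≤ 0}

open Classical in
/-- The positions `z` of the particles in `A`, and the positions of the children of a particle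
located at `x`. -/
noncomputable def childPosition (A : Set (List ℕ)) (z : List ℕ → ℝ) (x : ℝ) (e : ℕ → ℝ)
    (v : List ℕ) : ℝ :=
  if v ∈ A then z v else x + e (v.getLastD 0)

variable {A : Set (List ℕ)} {w : List ℕ}

theorem IsPrefixFree.concat_notMem (hA : IsPrefixFree A) (hw : w ∈ A) (i : ℕ) : w ++ [i] ∉ A := by
  intro h
  have := hA w hw _ h (List.prefix_append w [i])
  simp at this

theorem childPosition_of_mem {z : List ℕ → ℝ} {x : ℝ} {e : ℕ → ℝ} {v : List ℕ} (hv : v ∈ A) :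
    childPosition A z x e v = z v := if_pos hv

theorem IsPrefixFree.childPosition_concat (hA : IsPrefixFree A) (hw : w ∈ A) {z : List ℕ → ℝ}
    {x : ℝ} {e : ℕ → ℝ} (i : ℕ) : childPosition A z x e (w ++ [i]) = x + e i := by
  simp [childPosition, hA.concat_notMem hw i]

theorem IsPrefixFree.replaceByChildren (hA : IsPrefixFree A) (hw : w ∈ A) (x : ℝ) (e : ℕ → ℝ) :
    IsPrefixFree (replaceByChildren A w x e) := by
  rintro v (⟨hv, hvw⟩ | ⟨i, rfl, -⟩) v' (⟨hv', hvw'⟩ | ⟨j, rfl, -⟩) h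
  · exact hA v hv v' hv' h
  · rcases List.prefix_concat_iff.1 h with h | h
    · exact h
    · exact absurd (hA v hv w hw h) hvw
  · exact absurd (hA w hw v' hv' ((List.prefix_append w [i]).trans h)).symm hvw'
  · exact h.eq_of_length (by simp)

theorem IsPrefixFree.append_ne (hA : IsPrefixFree A) (hw : w ∈ A) {x : ℝ} {e : ℕ → ℝ}
    {v : List ℕ} (hv : v ∈ PrefAttach.replaceByChildren A w x e) (u : List ℕ) : v ++ u ≠ w := by
  intro h
  rcases hv with ⟨hv, hvw⟩ | ⟨i, rfl, -⟩
  · exact hvw (hA v hv w hw ⟨u, h⟩)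
  · simpa using congrArg List.length h

/-- No label of the forest after the replacement equals `w`, so the offspring of `w` is never read
again. This is the independence used when that offspring is revealed. -/
theorem IsPrefixFree.forestEvent_congr (hA : IsPrefixFree A) (hw : w ∈ A) {k : ℕ} {l x : ℝ}
    {z : List ℕ → ℝ} {e : ℕ → ℝ} {d d' : List ℕ → ℕ → ℝ} (h : ∀ v, v ≠ w → d v = d' v)
    (hd : d ∈ forestEvent k l (PrefAttach.replaceByChildren A w x e) z) :
    d' ∈ forestEvent k l (PrefAttach.replaceByChildren A w x e) z := by
  have key : ∀ v ∈ PrefAttach.replaceByChildren A w x e,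
      (fun u => d (v ++ u)) = fun u => d' (v ++ u) :=
    fun v hv => funext fun u => h _ (hA.append_ne hw hv u)
  refine hd.imp (fun hd => ?_) ?_
  · refine hd.trans_le (Set.encard_le_encard ?_)
    rintro v ⟨v', hv', u, hu, rfl⟩
    exact ⟨v', hv', u, key v' hv' ▸ hu, rfl⟩
  · rintro ⟨v', hv', u, hu, hl⟩
    exact ⟨v', hv', u, key v' hv' ▸ hu, key v' hv' ▸ hl⟩

/-- Passing from `w` to its children removes the particle `w` and adds none, so putting `w` back
raises the number of particles by one. -/
theorem IsPrefixFree.mem_forestEvent_succ (hA : IsPrefixFree A) (hw : w ∈ A) {k : ℕ} {l : ℝ}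
    {z : List ℕ → ℝ} (hz : z w ≤ 0) {d : List ℕ → ℕ → ℝ}
    (hd : d ∈ forestEvent k l (PrefAttach.replaceByChildren A w (z w) (d w))
      (childPosition A z (z w) (d w))) :
    d ∈ forestEvent (k + 1) l A z := by
  have key : ∀ v ∈ PrefAttach.replaceByChildren A w (z w) (d w), ∀ u,
      u ∈ killedWalk (childPosition A z (z w) (d w) v) (fun u => d (v ++ u)) →
      ∃ v' ∈ A, ∃ u' ∈ killedWalk (z v') (fun u => d (v' ++ u)), v ++ u = v' ++ u' ∧
        position (childPosition A z (z w) (d w) v) (fun u => d (v ++ u)) u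
          = position (z v') (fun u => d (v' ++ u)) u' := by
    rintro v (⟨hv, -⟩ | ⟨i, rfl, -⟩) u hu
    · rw [childPosition_of_mem hv] at hu ⊢
      exact ⟨v, hv, u, hu, rfl, rfl⟩
    · rw [hA.childPosition_concat hw] at hu ⊢
      simp only [List.append_assoc, List.cons_append, List.nil_append] at hu ⊢
      refine ⟨w, hw, i :: u, cons_mem_killedWalk.2 ⟨hz, ?_⟩, rfl, ?_⟩
      · simpa using hu
      · rw [position_cons]
        simp
  refine hd.imp (fun hd => ?_) ?_
  · have hsub : insert w (forest (PrefAttach.replaceByChildren A w (z w) (d w))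
        (childPosition A z (z w) (d w)) d) ⊆ forest A z d := by
      rintro v (rfl | ⟨v', hv', u, hu, rfl⟩)
      · exact ⟨v, hw, [], nil_mem_killedWalk.2 hz, by simp⟩
      · obtain ⟨v'', h1, u', h2, h3, -⟩ := key v' hv' u hu
        exact ⟨v'', h1, u', h2, h3⟩
    refine lt_of_lt_of_le ?_ (Set.encard_le_encard hsub)
    rw [Set.encard_insert_of_notMem]
    · push_cast
      exact (ENat.add_lt_add_iff_right ENat.one_ne_top).2 hd
    · rintro ⟨v', hv', u, -, h⟩
      exact hA.append_ne hw hv' u h.symm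
  · rintro ⟨v, hv, u, hu, hl⟩
    obtain ⟨v', h1, u', h2, -, h3⟩ := key v hv u hu
    exact ⟨v', h1, u', h2, h3 ▸ hl⟩

theorem forestEvent_root (k : ℕ) (l x : ℝ) {d : List ℕ → ℕ → ℝ} :
    d ∈ forestEvent k l {[]} (fun _ => x) ↔
      (k : ℕ∞) < (killedWalk x d).encard ∨ ∃ v ∈ killedWalk x d, position x d v ≤ l := by
  simp [forestEvent, forest]

end Walk

/-! ### Exploring the graph -/

section Graph

variable {V : Type*}

/-- The vertices that can be reached from `A` on a path with all vertices, except possibly the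
first one, in `U`. -/
def reach (G : SimpleGraph V) (U A : Set V) : Set V :=
  {v | ∃ a ∈ A, Relation.ReflTransGen (fun x y => G.Adj x y ∧ y ∈ U) a v}

/-- More than `k` vertices, or a vertex in `L`, can be reached from `A`. -/
def reachEvent (k : ℕ) (L U A : Set V) : Set (SimpleGraph V) :=
  {G | (k : ℕ∞) < (reach G U A).encard ∨ (reach G U A ∩ L).Nonempty}

theorem reach_mono_right {G : SimpleGraph V} {U A A' : Set V} (h : A ⊆ A') :
    reach G U A ⊆ reach G U A' := fun _ ⟨a, ha, hv⟩ => ⟨a, h ha, hv⟩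

theorem reachEvent_mono_right {k : ℕ} {L U A A' : Set V} (h : A ⊆ A') :
    reachEvent k L U A ⊆ reachEvent k L U A' := fun _ hG =>
  hG.imp (fun hG => hG.trans_le (Set.encard_le_encard (reach_mono_right h)))
    fun hG => hG.mono (Set.inter_subset_inter_left _ (reach_mono_right h))

/-- Cut a path at its last visit to `a`: the rest avoids `a` and starts in a neighbour of `a`. -/
theorem reach_subset_insert (G : SimpleGraph V) (U A : Set V) (a : V) :
    reach G U A ⊆ insert a (reach G (U \ {a}) (A \ {a} ∪ {v | G.Adj a v ∧ v ∈ U \ {a}})) := by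
  rintro v ⟨a₀, ha₀, hv⟩
  induction hv with
  | refl =>
    by_cases h : a₀ = a
    · exact Or.inl h
    · exact Or.inr ⟨a₀, Or.inl ⟨ha₀, h⟩, .refl⟩
  | @tail x y _ hxy ih =>
    by_cases h : y = a
    · exact Or.inl h
    · rcases ih with rfl | ⟨b, hb, hbx⟩
      · exact Or.inr ⟨y, Or.inr ⟨hxy.1, hxy.2, h⟩, .refl⟩
      · exact Or.inr ⟨b, hb, hbx.tail ⟨hxy.1, hxy.2, h⟩⟩

theorem mem_reachEvent_of_succ {G : SimpleGraph V} {k : ℕ} {L U A : Set V} {a : V} (ha : a ∉ L)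
    (h : G ∈ reachEvent (k + 1) L U A) :
    G ∈ reachEvent k L (U \ {a}) (A \ {a} ∪ {v | G.Adj a v ∧ v ∈ U \ {a}}) := by
  have hsub := reach_subset_insert G U A a
  refine h.imp (fun h => ?_) ?_
  · have h2 := (h.trans_le (Set.encard_le_encard hsub)).trans_le (Set.encard_insert_le _ _)
    push_cast at h2
    exact (ENat.add_lt_add_iff_right ENat.one_ne_top).1 h2
  · rintro ⟨v, hv, hvL⟩
    rcases hsub hv with rfl | hv
    · exact absurd hvL ha
    · exact ⟨v, hv, hvL⟩

/-- Admissible paths never visit `a`, hence use no edge at `a`; so the edges at `a` may be revealed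
and discarded. -/
theorem reachEvent_congr {G G' : SimpleGraph V} {k : ℕ} {L U A : Set V} {a : V} (haU : a ∉ U)
    (haA : a ∉ A) (h : ∀ x y, x ≠ a → y ≠ a → G.Adj x y → G'.Adj x y)
    (hG : G ∈ reachEvent k L U A) : G' ∈ reachEvent k L U A := by
  have hsub : reach G U A ⊆ reach G' U A := by
    rintro v ⟨a₀, ha₀, hv⟩
    have : v ≠ a ∧ Relation.ReflTransGen (fun x y => G'.Adj x y ∧ y ∈ U) a₀ v := by
      induction hv with
      | refl => exact ⟨fun h => haA (h ▸ ha₀), .refl⟩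
      | @tail x y _ hxy ih =>
        have hy : y ≠ a := fun h => haU (h ▸ hxy.2)
        exact ⟨hy, ih.2.tail ⟨h x y ih.1 hy hxy.1, hxy.2⟩⟩
    exact ⟨a₀, ha₀, this.2⟩
  exact hG.imp (fun hG => hG.trans_le (Set.encard_le_encard hsub))
    fun hG => hG.mono (Set.inter_subset_inter_left _ hsub)

theorem reachEvent_empty (k : ℕ) (L U : Set V) : reachEvent k L U ∅ = ∅ := by
  simp [reachEvent, reach]

theorem lt_encard_supp_imp_mem_reachEvent {G : SimpleGraph V} {k : ℕ} {L : Set V} {v : V}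
    (h : (k : ℕ∞) < (G.connectedComponentMk v).supp.encard) :
    G ∈ reachEvent k L Set.univ {v} := by
  refine Or.inl (h.trans_le (Set.encard_le_encard fun x hx => ⟨v, rfl, ?_⟩))
  have h1 : G.Reachable v x := (SimpleGraph.ConnectedComponent.exact hx).symm
  rw [SimpleGraph.reachable_iff_reflTransGen] at h1
  exact Relation.ReflTransGen.mono (r := G.Adj) (fun x y hxy => ⟨hxy, trivial⟩) _ _ h1

end Graph

/-- All events about a finite random graph thereby become measurable, in particular `reachEvent`. -/
instance (V : Type*) [Finite V] : DiscreteMeasurableSpace (SimpleGraph V) := by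
  have : MeasurableSingletonClass (SimpleGraph V) := ⟨fun G => by
    have : ({G} : Set (SimpleGraph V)) = SimpleGraph.Adj ⁻¹' {G.Adj} := by
      ext G'
      exact SimpleGraph.adj_inj.symm
    rw [this]
    exact SimpleGraph.measurable_adj (measurableSet_singleton _)⟩
  infer_instance

/-! ### The set of cells hit by a Poisson process -/

section HitComparison

variable {n : ℕ}

theorem measurable_setOf_comp {Ω : Type*} [MeasurableSpace Ω] {Q : Ω → Fin n → Prop}
    (hQ : ∀ j, MeasurableSet {ω | Q ω j}) (h : Set (Fin n) → ENNReal) :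
    Measurable fun ω => h {j | Q ω j} := by
  have h1 : Measurable Q := measurable_pi_lambda _ fun j => measurable_to_prop (by
    have : (fun ω => Q ω j) ⁻¹' {True} = {ω | Q ω j} := by ext; simp
    exact this ▸ hQ j)
  exact (measurable_of_countable fun b : Fin n → Prop => h {j | b j}).comp h1

/-- Split according to the vector `c` of counts. Configurations with an infinite count are dropped,
which is harmless for an inequality. -/
theorem lintegral_poisson_support_le (μ : Measure (ℕ → ℝ)) {ν : Measure ℝ}
    (hμ : IsOrderedPoissonProcess μ ν id) {B : Fin n → Set ℝ} (hB : ∀ j, MeasurableSet (B j))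
    (hd : Pairwise fun i j => Disjoint (B i) (B j)) (hfin : ∀ j, ν (B j) ≠ ⊤)
    (h : Set (Fin n) → ENNReal) :
    ∫⁻ c, h {j | c j ≠ 0} ∂(Measure.infinitePi fun j => poissonMeasure (ν (B j)).toNNReal)
      ≤ ∫⁻ e, h {j | ∃ i, e i ∈ B j} ∂μ := by
  let E : (Fin n → ℕ) → Set (ℕ → ℝ) := fun c => {e | ∀ j, {k | e k ∈ B j}.encard = (c j : ℕ∞)}
  have hE : ∀ c, MeasurableSet (E c) := by
    intro c
    have : E c = ⋂ j, {e | {k | e k ∈ B j}.encard = (c j : ℕ∞)} := by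
      ext e
      simp [E]
    rw [this]
    exact MeasurableSet.iInter fun j =>
      measurableSet_encard_eq (f := fun p : ℕ → ℝ => {k | p k ∈ B j})
        (fun k => measurable_pi_apply (X := fun _ : ℕ => ℝ) k (hB j)) (c j)
  have hdisj : Pairwise (Function.onFun Disjoint E) := by
    intro c c' hcc'
    refine Set.disjoint_left.2 fun e he he' => hcc' (funext fun j => ?_)
    exact_mod_cast (he j).symm.trans (he' j)
  rw [lintegral_countable']
  calc ∑' c : Fin n → ℕ, h {j | c j ≠ 0} *
        (Measure.infinitePi fun j => poissonMeasure (ν (B j)).toNNReal) {c}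
      = ∑' c : Fin n → ℕ, ∫⁻ e in E c, h {j | ∃ i, e i ∈ B j} ∂μ := by
        refine tsum_congr fun c => ?_
        rw [Measure.infinitePi_singleton_of_fintype, ← hμ.counts n B c hB hd hfin]
        have : ∀ e ∈ E c, h {j | ∃ i, e i ∈ B j} = h {j | c j ≠ 0} := by
          intro e he
          congr 1
          ext j
          have h1 : {k | e k ∈ B j}.Nonempty ↔ c j ≠ 0 := by
            rw [← Set.encard_ne_zero, he j]
            simp
          exact h1
        rw [setLIntegral_congr_fun (hE c) this, setLIntegral_const]
        rfl
    _ = ∫⁻ e in ⋃ c, E c, h {j | ∃ i, e i ∈ B j} ∂μ := (lintegral_iUnion hE hdisj _).symm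
    _ ≤ _ := setLIntegral_le_lintegral _ _

open unitInterval in
theorem map_ne_zero_poissonMeasure (r : NNReal) {q : ℝ} (hq : q = 1 - Real.exp (-r)) :
    (poissonMeasure r).map (fun c => c ≠ 0)
      = (volume : Measure I).map (fun u : I => (u : ℝ) < q) := by
  have m1 : Measurable fun c : ℕ => c ≠ 0 := .of_discrete
  have m2 : Measurable fun u : I => (u : ℝ) < q :=
    measurableSet_setOfPred.1 (measurableSet_lt measurable_subtype_coe measurable_const)
  have := Measure.isProbabilityMeasure_map (μ := poissonMeasure r) m1.aemeasurable
  have := Measure.isProbabilityMeasure_map (μ := (volume : Measure I)) m2.aemeasurable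
  have hq01 : q ∈ I := by
    have := Real.exp_pos (-(r : ℝ))
    have : Real.exp (-(r : ℝ)) ≤ 1 := Real.exp_le_one_iff.2 (by simp)
    constructor <;> linarith
  have key : (poissonMeasure r).map (fun c => c ≠ 0) {False}
      = (volume : Measure I).map (fun u : I => (u : ℝ) < q) {False} := by
    rw [Measure.map_apply m1 (measurableSet_singleton _),
      Measure.map_apply m2 (measurableSet_singleton _)]
    have e1 : (fun c : ℕ => c ≠ 0) ⁻¹' {False} = {0} := by
      ext c
      simp
    have e2 : (fun u : I => (u : ℝ) < q) ⁻¹' {False} = Set.Ici ⟨q, hq01⟩ := by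
      ext u
      simp [← Subtype.coe_le_coe]
    rw [e1, e2, poissonMeasure_singleton, unitInterval.volume_Ici]
    simp [hq]
  refine Measure.ext_of_singleton fun b => ?_
  by_cases hb : b
  · have e3 : ({b} : Set Prop) = {False}ᶜ := by
      ext b'
      by_cases hb' : b' <;> simp [hb, hb']
    rw [e3, prob_compl_eq_one_sub (measurableSet_singleton _),
      prob_compl_eq_one_sub (measurableSet_singleton _), key]
  · rw [show b = False from propext (iff_false_intro hb)]
    exact key

-- The cells are hit independently, with probabilities `1 - exp (-ν (B j))`, so the set of hit cells
-- has the law of thresholded independent uniforms; lowering the thresholds shrinks the set.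
open unitInterval in
theorem lintegral_hit_le (μ : Measure (ℕ → ℝ)) {ν : Measure ℝ}
    (hμ : IsOrderedPoissonProcess μ ν id) {B : Fin n → Set ℝ} (hB : ∀ j, MeasurableSet (B j))
    (hd : Pairwise fun i j => Disjoint (B i) (B j)) (hfin : ∀ j, ν (B j) ≠ ⊤) {p : Fin n → ℝ}
    (hp : ∀ j, p j ≤ 1 - Real.exp (-(ν (B j)).toReal)) {h : Set (Fin n) → ENNReal}
    (hh : Monotone h) :
    ∫⁻ u, h {j | (u j : ℝ) < p j} ∂(Measure.infinitePi fun _ => (volume : Measure I))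
      ≤ ∫⁻ e, h {j | ∃ i, e i ∈ B j} ∂μ := by
  refine le_trans ?_ (lintegral_poisson_support_le μ hμ hB hd hfin h)
  set q : Fin n → ℝ := fun j => 1 - Real.exp (-(ν (B j)).toReal) with hq
  have m1 : Measurable fun c : ℕ => c ≠ 0 := .of_discrete
  have m2 : ∀ j, Measurable fun u : I => (u : ℝ) < q j := fun j =>
    measurableSet_setOfPred.1 (measurableSet_lt measurable_subtype_coe measurable_const)
  have m3 : Measurable fun b : Fin n → Prop => h {j | b j} := measurable_of_countable _
  calc ∫⁻ u, h {j | (u j : ℝ) < p j} ∂(Measure.infinitePi fun _ => (volume : Measure I))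
      ≤ ∫⁻ u, h {j | (u j : ℝ) < q j} ∂(Measure.infinitePi fun _ => (volume : Measure I)) :=
        lintegral_mono fun u => hh fun j hj => lt_of_lt_of_le hj (hp j)
    _ = ∫⁻ b, h {j | b j} ∂(Measure.infinitePi fun j =>
          (volume : Measure I).map (fun u : I => (u : ℝ) < q j)) := by
        rw [← Measure.infinitePi_map_pi (fun _ => (volume : Measure I)) m2,
          lintegral_map m3 (measurable_pi_lambda (fun (u : Fin n → I) j => (u j : ℝ) < q j)
            fun j => (m2 j).comp (measurable_pi_apply j))]
    _ = ∫⁻ b, h {j | b j} ∂(Measure.infinitePi fun j =>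
          (poissonMeasure (ν (B j)).toNNReal).map (fun c => c ≠ 0)) := by
        have e : ∀ j, (volume : Measure I).map (fun u : I => (u : ℝ) < q j)
            = (poissonMeasure (ν (B j)).toNNReal).map (fun c => c ≠ 0) :=
          fun j => (map_ne_zero_poissonMeasure _ rfl).symm
        simp_rw [e]
    _ = _ := by
        rw [← Measure.infinitePi_map_pi (fun j => poissonMeasure (ν (B j)).toNNReal) (fun _ => m1),
          lintegral_map m3 (measurable_pi_lambda (fun (c : Fin n → ℕ) j => c j ≠ 0) fun j =>
            m1.comp (measurable_pi_apply j))]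

end HitComparison

/-! ### Stochastic domination of the component by the walk -/

section Domination

open unitInterval

variable {n : ℕ}

/-- The graph in which `i ≠ j` are joined when the label of `{i, j}` is below a threshold. -/
def thresholdGraph (p : Fin n → Fin n → ℝ) (u : Sym2 (Fin n) → I) : SimpleGraph (Fin n) where
  Adj i j := i ≠ j ∧ (u s(i, j) : ℝ) < p (min i j) (max i j)
  symm := ⟨fun i j h => ⟨h.1.symm, by rw [Sym2.eq_swap, min_comm, max_comm]; exact h.2⟩⟩
  loopless := ⟨fun i h => h.1 rfl⟩

theorem measurable_thresholdGraph (p : Fin n → Fin n → ℝ) : Measurable (thresholdGraph p) := by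
  refine SimpleGraph.measurable_iff_adj.2 fun i j => measurableSet_setOfPred.1 ?_
  have h : MeasurableSet {u : Sym2 (Fin n) → I | (u s(i, j) : ℝ) < p (min i j) (max i j)} :=
    measurableSet_lt (measurable_subtype_coe.comp (measurable_pi_apply s(i, j))) measurable_const
  exact (MeasurableSet.const (i ≠ j)).inter h

/-- The law of independent uniform labels of the pairs of vertices. -/
noncomputable def labelsLaw (n : ℕ) : Measure (Sym2 (Fin n) → I) :=
  Measure.infinitePi fun _ => volume

instance : IsProbabilityMeasure (labelsLaw n) := by
  unfold labelsLaw; infer_instance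

/-- One exploration step: the labels of the pairs at `a` are integrated separately from the rest.
The threshold `0` at `v = a` is never undercut, which rules out the loop. -/
theorem labelsLaw_reachEvent_succ_le (p : Fin n → Fin n → ℝ) (k : ℕ) {L U A : Set (Fin n)}
    {a : Fin n} (ha : a ∉ L) :
    labelsLaw n {u | thresholdGraph p u ∈ reachEvent (k + 1) L U A}
      ≤ ∫⁻ u : Fin n → I, labelsLaw n {u' | thresholdGraph p u' ∈ reachEvent k L (U \ {a})
          (A \ {a} ∪ {v | (u v : ℝ) < (if v = a then 0 else p (min a v) (max a v)) ∧
            v ∈ U \ {a}})} ∂(Measure.infinitePi fun _ => volume) := by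
  set H : Set (Fin n) → ENNReal := fun J => labelsLaw n {u' | thresholdGraph p u' ∈
    reachEvent k L (U \ {a}) (A \ {a} ∪ {v | v ∈ J ∧ v ∈ U \ {a}})} with hH
  have hm : ∀ s : Set (SimpleGraph (Fin n)), MeasurableSet {u | thresholdGraph p u ∈ s} :=
    fun s => measurable_thresholdGraph p (MeasurableSet.of_discrete (s := s))
  have h1 := infinitePi_le_lintegral_piecewise (fun _ : Sym2 (Fin n) => (volume : Measure I))
    {e | a ∈ e} (hm (reachEvent (k + 1) L U A))
    (B := fun u => {u' | thresholdGraph p u' ∈ reachEvent k L (U \ {a})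
      (A \ {a} ∪ {v | (thresholdGraph p u).Adj a v ∧ v ∈ U \ {a}})})
    (fun u hu => mem_reachEvent_of_succ ha hu) (by
      intro x x' y hx hy h
      have e1 : ∀ v, (thresholdGraph p x).Adj a v ↔ (thresholdGraph p x').Adj a v := by
        intro v
        simp only [thresholdGraph]
        rw [hx s(a, v) (Sym2.mem_mk_left a v)]
      simp only [e1] at h
      refine reachEvent_congr (a := a) (by simp) (by simp) (fun v w hv hw hvw => ?_) h
      refine ⟨hvw.1, ?_⟩
      rw [← hy s(v, w) (by simp [hv.symm, hw.symm])]
      exact hvw.2)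
  refine h1.trans (le_of_eq ?_)
  have hinj : Function.Injective fun v : Fin n => s(a, v) := fun v w h => Sym2.congr_right.1 h
  have h2 := measurePreserving_comp_infinitePi (volume : Measure I) hinj
  have h3 : ∀ v : Fin n, MeasurableSet {u : Fin n → I |
      (u v : ℝ) < (if v = a then 0 else p (min a v) (max a v))} := fun v =>
    measurableSet_lt (measurable_subtype_coe.comp (measurable_pi_apply v)) measurable_const
  have h4 := h2.lintegral_comp (measurable_setOf_comp h3 H)
  refine Eq.trans ?_ h4
  refine lintegral_congr fun u => ?_
  have h5 : {v | (thresholdGraph p u).Adj a v ∧ v ∈ U \ {a}}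
      = {v | (u s(a, v) : ℝ) < (if v = a then 0 else p (min a v) (max a v)) ∧ v ∈ U \ {a}} := by
    ext v
    by_cases hv : v = a
    · simp [hv]
    · simp [thresholdGraph, hv, Ne.symm hv]
  simp only [hH, h5]
  rfl

/-- Induction on `k` with the invariant that every active vertex has an active particle in its cell.
One vertex and one such particle are explored per step; surplus particles only help the walk. -/
theorem labelsLaw_reachEvent_le (p : Fin n → Fin n → ℝ) {μ : Measure (ℕ → ℝ)}
    [IsProbabilityMeasure μ] {ν : Measure ℝ} (hμ : IsOrderedPoissonProcess μ ν id)
    {C : Fin n → Set ℝ} (hC : ∀ j, MeasurableSet (C j))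
    (hd : Pairwise fun i j => Disjoint (C i) (C j)) (hC0 : ∀ j, C j ⊆ Set.Iic 0)
    {L : Set (Fin n)} {l : ℝ} (hL : ∀ a ∈ L, C a ⊆ Set.Iic l)
    (hfin : ∀ (z : ℝ) (j : Fin n), ν {e | z + e ∈ C j} ≠ ⊤)
    (hp : ∀ a ∉ L, ∀ z ∈ C a, ∀ j, j ≠ a →
      p (min a j) (max a j) ≤ 1 - Real.exp (-(ν {e | z + e ∈ C j}).toReal))
    (k : ℕ) (U A : Set (Fin n)) (W : Set (List ℕ)) (z : List ℕ → ℝ) (hW : IsPrefixFree W)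
    (hz : ∀ w ∈ W, z w ≤ 0) (hA : ∀ a ∈ A, ∃ w ∈ W, z w ∈ C a) :
    labelsLaw n {u | thresholdGraph p u ∈ reachEvent k L U A}
      ≤ Measure.infinitePi (fun _ => μ) (forestEvent k l W z) := by
  induction k generalizing U A W z with
  | zero =>
    rcases A.eq_empty_or_nonempty with rfl | ⟨a, ha⟩
    · simp [reachEvent_empty]
    · obtain ⟨w, hw, -⟩ := hA a ha
      -- A single active particle already exceeds the count `0`.
      have : forestEvent 0 l W z = Set.univ := by
        refine Set.eq_univ_of_forall fun d => Or.inl ?_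
        simp only [Nat.cast_zero, Set.encard_pos]
        exact ⟨w, w, hw, [], nil_mem_killedWalk.2 (hz w hw), by simp⟩
      rw [this, measure_univ]
      exact prob_le_one
  | succ k ih =>
    rcases A.eq_empty_or_nonempty with rfl | ⟨a, ha⟩
    · simp [reachEvent_empty]
    obtain ⟨w, hw, hwa⟩ := hA a ha
    by_cases haL : a ∈ L
    -- Reaching `L` costs nothing: the matching particle lies in `Iic l`, so the walk's event is
    -- certain.
    · have : forestEvent (k + 1) l W z = Set.univ := by
        refine Set.eq_univ_of_forall fun d => Or.inr ⟨w, hw, [], ?_, ?_⟩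
        · exact nil_mem_killedWalk.2 (hz w hw)
        · rw [position_nil]
          exact hL a haL hwa
      rw [this, measure_univ]
      exact prob_le_one
    refine (labelsLaw_reachEvent_succ_le p k haL).trans ?_
    refine le_trans ?_ (lintegral_update_le_infinitePi (fun _ => μ) w
      (measurableSet_forestEvent (k + 1) l W z)
      (B := fun e => forestEvent k l (replaceByChildren W w (z w) e) (childPosition W z (z w) e))
      (fun d hd => hW.mem_forestEvent_succ hw (hz w hw) hd)
      (fun e d d' hdd' hd => hW.forestEvent_congr hw hdd' hd))
    refine (lintegral_hit_le μ hμ (B := fun j => {e | z w + e ∈ C j})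
      (fun j => (measurable_const_add (z w)) (hC j))
      (fun i j hij => (hd hij).preimage _) (hfin (z w))
      (h := fun J => labelsLaw n {u' | thresholdGraph p u' ∈ reachEvent k L (U \ {a})
          (A \ {a} ∪ {v | v ∈ J ∧ v ∈ U \ {a}})}) ?_ ?_).trans (lintegral_mono fun e => ?_)
    · intro j
      split_ifs with hj
      · have : Real.exp (-(ν {e | z w + e ∈ C j}).toReal) ≤ 1 :=
          Real.exp_le_one_iff.2 (by simp)
        linarith
      · exact hp a haL _ hwa j hj
    · intro J J' hJ
      refine measure_mono fun u hu => reachEvent_mono_right ?_ hu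
      exact Set.union_subset_union_right _ fun v hv => ⟨hJ hv.1, hv.2⟩
    · refine ih _ _ _ _ (hW.replaceByChildren hw _ _) ?_ ?_
      · rintro v (⟨hv, -⟩ | ⟨i, rfl, hi⟩)
        · rw [childPosition_of_mem hv]
          exact hz v hv
        · rwa [hW.childPosition_concat hw]
      · rintro b (⟨hb, hba⟩ | ⟨⟨i, hi⟩, -⟩)
        -- The cells of `a` and `b` are disjoint, so the particle matched with `b` is not the one
        -- being replaced.
        · obtain ⟨w', hw', hwb⟩ := hA b hb
          refine ⟨w', Or.inl ⟨hw', ?_⟩, ?_⟩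
          · rintro rfl
            exact Set.disjoint_left.1 (hd hba) hwb hwa
          · rwa [childPosition_of_mem hw']
        -- The child that hits the cell of `b` survives because cells lie in `Iic 0`.
        · refine ⟨w ++ [i], Or.inr ⟨i, rfl, hC0 b hi⟩, ?_⟩
          rwa [hW.childPosition_concat hw]

end Domination

/-! ### Vertices as cells of the half-line -/

section Cells

variable {n : ℕ}

/-- The positions that correspond to the vertex `i` of the graph with `n` vertices. -/
def cell (i : Fin n) : Set ℝ :=
  {z | Real.exp z ∈ Set.Ioc ((i : ℕ) / (n : ℝ)) (((i : ℕ) + 1) / (n : ℝ))}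

theorem measurableSet_cell (i : Fin n) : MeasurableSet (cell i) :=
  Real.measurable_exp measurableSet_Ioc

theorem natCast_pos_of_fin (i : Fin n) : (0 : ℝ) < n := by
  exact_mod_cast (Nat.zero_le _).trans_lt i.2

theorem exp_lt_exp_of_mem_cell {i j : Fin n} (hij : i < j) {y z : ℝ} (hy : y ∈ cell i)
    (hz : z ∈ cell j) : y < z := by
  rw [← Real.exp_lt_exp]
  refine (hy.2.trans ?_).trans_lt hz.1
  have := natCast_pos_of_fin i
  gcongr
  exact_mod_cast hij

theorem pairwise_disjoint_cell : Pairwise fun i j : Fin n => Disjoint (cell i) (cell j) := by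
  intro i j hij
  refine Set.disjoint_left.2 fun z hz hz' => ?_
  rcases lt_or_gt_of_ne hij with h | h
  · exact lt_irrefl z (exp_lt_exp_of_mem_cell h hz hz')
  · exact lt_irrefl z (exp_lt_exp_of_mem_cell h hz' hz)

theorem cell_subset_Iic (i : Fin n) : cell i ⊆ Set.Iic 0 := by
  intro z hz
  have := natCast_pos_of_fin i
  have h : Real.exp z ≤ 1 := hz.2.trans ((div_le_one this).2 (by exact_mod_cast i.2))
  exact Real.exp_le_one_iff.1 h

/-- The substitution `x = exp z` maps the cell onto an interval of length `1/n`. -/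
theorem lintegral_exp_cell (i : Fin n) :
    ∫⁻ z in cell i, ENNReal.ofReal (Real.exp z) = 1 / (n : ENNReal) := by
  have hn := natCast_pos_of_fin i
  have h := lintegral_image_eq_lintegral_abs_deriv_mul (measurableSet_cell i)
    (fun z _ => (Real.hasDerivAt_exp z).hasDerivWithinAt) Real.exp_injective.injOn (fun _ => 1)
  simp only [mul_one, abs_of_pos (Real.exp_pos _), lintegral_const, one_mul,
    Measure.restrict_apply MeasurableSet.univ, Set.univ_inter] at h
  rw [← h]
  have himg : Real.exp '' cell i = Set.Ioc ((i : ℕ) / (n : ℝ)) (((i : ℕ) + 1) / (n : ℝ)) := by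
    refine Set.image_preimage_eq_of_subset ?_
    intro x hx
    rw [Real.range_exp]
    exact lt_of_le_of_lt (by positivity) hx.1
  rw [himg, Real.volume_Ioc, ← sub_div, add_sub_cancel_left, ENNReal.ofReal_div_of_pos hn,
    ENNReal.ofReal_one, ENNReal.ofReal_natCast]

theorem expMeasure_neg_mem_cell (i : Fin n) :
    expMeasure 1 {x | -x ∈ cell i} = 1 / (n : ENNReal) := by
  have hm : MeasurableSet {x : ℝ | -x ∈ cell i} := measurable_neg (measurableSet_cell i)
  have h1 : expMeasure 1 {x | -x ∈ cell i}
      = ∫⁻ x in {x | -x ∈ cell i}, ENNReal.ofReal (Real.exp (-x)) := by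
    unfold expMeasure gammaMeasure
    rw [withDensity_apply _ hm]
    refine setLIntegral_congr_fun hm fun x hx => ?_
    have hx0 : 0 ≤ x := by simpa using cell_subset_Iic i hx
    have h := exponentialPDF_of_nonneg (r := 1) hx0
    rwa [one_mul, one_mul] at h
  rw [h1, ← lintegral_exp_cell i]
  have h2 := (Measure.measurePreserving_neg (volume : Measure ℝ)).setLIntegral_comp_preimage_emb
    (MeasurableEquiv.neg ℝ).measurableEmbedding (fun z => ENNReal.ofReal (Real.exp z)) (cell i)
  exact h2

end Cells

/-! ### Edge probabilities against the walk's intensity -/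

section Intensity

variable {γ β : ℝ}

theorem measurable_intensity_density (γ β : ℝ) : Measurable fun x : ℝ => ENNReal.ofReal
    (β * ((Set.Ioi (0 : ℝ)).indicator (fun t => Real.exp (γ * t)) x
      + (Set.Iio (0 : ℝ)).indicator (fun t => Real.exp ((1 - γ) * t)) x)) := by
  refine ENNReal.measurable_ofReal.comp (measurable_const.mul ?_)
  exact ((by fun_prop : Measurable fun t => Real.exp (γ * t)).indicator measurableSet_Ioi).add
    ((by fun_prop : Measurable fun t => Real.exp ((1 - γ) * t)).indicator measurableSet_Iio)

instance : SFinite (intensity γ β) := by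
  unfold intensity; infer_instance

theorem setLIntegral_exp_mul_Iic_ne_top {c : ℝ} (hc : 0 < c) (x : ℝ) :
    ∫⁻ t in Set.Iic x, ENNReal.ofReal (Real.exp (c * t)) ≠ ⊤ :=
  (integrableOn_exp_mul_Iic hc x).lintegral_lt_top.ne

theorem intensity_Iic_ne_top (hγ : 0 < γ) (hγ' : γ < 1) (hβ : 0 ≤ β) (x : ℝ) :
    intensity γ β (Set.Iic x) ≠ ⊤ := by
  unfold intensity
  rw [withDensity_apply _ measurableSet_Iic]
  have hle : ∀ t : ℝ, ENNReal.ofReal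
      (β * ((Set.Ioi (0 : ℝ)).indicator (fun t => Real.exp (γ * t)) t
        + (Set.Iio (0 : ℝ)).indicator (fun t => Real.exp ((1 - γ) * t)) t))
      ≤ ENNReal.ofReal β * (ENNReal.ofReal (Real.exp (γ * t))
        + ENNReal.ofReal (Real.exp ((1 - γ) * t))) := by
    intro t
    rw [← ENNReal.ofReal_add (Real.exp_pos _).le (Real.exp_pos _).le, ← ENNReal.ofReal_mul hβ]
    gcongr
    · exact Set.indicator_le_self' (fun _ _ => (Real.exp_pos _).le) t
    · exact Set.indicator_le_self' (fun _ _ => (Real.exp_pos _).le) t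
  refine ((lintegral_mono hle).trans_lt ?_).ne
  rw [lintegral_const_mul' _ _ ENNReal.ofReal_ne_top, lintegral_add_left (by fun_prop)]
  exact ENNReal.mul_lt_top ENNReal.ofReal_lt_top (ENNReal.add_lt_top.2
    ⟨(setLIntegral_exp_mul_Iic_ne_top hγ x).lt_top,
      (setLIntegral_exp_mul_Iic_ne_top (sub_pos.2 hγ') x).lt_top⟩)

theorem intensity_univ (hγ : 0 < γ) (hβ : 0 < β) : intensity γ β Set.univ = ⊤ := by
  refine top_unique ?_
  calc (⊤ : ENNReal) = ∫⁻ _ in Set.Ioi (0 : ℝ), ENNReal.ofReal β := by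
        rw [setLIntegral_const, Real.volume_Ioi, ENNReal.mul_top]
        simpa using hβ
    _ ≤ intensity γ β (Set.Ioi 0) := by
        unfold intensity
        rw [withDensity_apply _ measurableSet_Ioi]
        refine setLIntegral_mono (measurable_intensity_density γ β) fun t ht => ?_
        refine ENNReal.ofReal_le_ofReal ?_
        have h0 : (0 : ℝ) < t := ht
        have h1 : 1 ≤ Real.exp (γ * t) := Real.one_le_exp (by positivity)
        rw [Set.indicator_of_mem ht, Set.indicator_of_notMem (by simp [h0.le]), add_zero]
        nlinarith
    _ ≤ _ := measure_mono (Set.subset_univ _)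

/-- With `s = n exp z` and `t = n exp (z + e)`, the density equals `β (max s t)^(γ-1) (min s t)^(-γ)
t`. Both exponents are negative, and `s`, `t` are at most the labels of their cells. -/
theorem le_density_of_mem_cell {n : ℕ} (hγ : 0 < γ) (hγ' : γ < 1) (hβ : 0 < β) {a j : Fin n}
    (hj : j ≠ a) {z e : ℝ} (hz : z ∈ cell a) (he : z + e ∈ cell j) :
    β * (max (label a) (label j)) ^ (γ - 1) * (min (label a) (label j)) ^ (-γ)
        * (n * Real.exp (z + e))
      ≤ β * ((Set.Ioi (0 : ℝ)).indicator (fun t => Real.exp (γ * t)) e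
        + (Set.Iio (0 : ℝ)).indicator (fun t => Real.exp ((1 - γ) * t)) e) := by
  have hn := natCast_pos_of_fin a
  set s := n * Real.exp z with hs
  set t := n * Real.exp (z + e) with ht
  have hs0 : 0 < s := by positivity
  have ht0 : 0 < t := by positivity
  have hsa : s ≤ label a := by
    have := hz.2
    rwa [le_div_iff₀ hn, mul_comm] at this
  have htj : t ≤ label j := by
    have := he.2
    rwa [le_div_iff₀ hn, mul_comm] at this
  have hst : Real.exp e = t / s := by
    rw [hs, ht, Real.exp_add]
    field_simp
  have hexp : ∀ c : ℝ, Real.exp (c * e) = (t / s) ^ c := by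
    intro c
    rw [← hst, ← Real.exp_mul, mul_comm]
  rw [mul_assoc, mul_assoc]
  refine mul_le_mul_of_nonneg_left ?_ hβ.le
  rcases lt_or_gt_of_ne hj with h | h
  · have h1 : e < 0 := by
      have := exp_lt_exp_of_mem_cell h he hz
      linarith
    have hl : label j ≤ label a := by
      unfold label
      have : (j : ℕ) ≤ (a : ℕ) := h.le
      have : ((j : ℕ) : ℝ) ≤ (a : ℕ) := by exact_mod_cast this
      linarith
    rw [Set.indicator_of_notMem (by simp [h1.le]), Set.indicator_of_mem (by exact h1), zero_add,
      hexp, max_eq_left hl, min_eq_right hl]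
    have e1 : (t / s) ^ (1 - γ) = s ^ (γ - 1) * (t ^ (-γ) * t) := by
      rw [Real.div_rpow ht0.le hs0.le, show 1 - γ = -γ + 1 by ring, Real.rpow_add ht0, Real.rpow_one,
        show γ - 1 = -(-γ + 1) by ring, Real.rpow_neg hs0.le]
      field_simp
    rw [e1]
    exact mul_le_mul (Real.rpow_le_rpow_of_nonpos hs0 hsa (by linarith))
      (mul_le_mul_of_nonneg_right (Real.rpow_le_rpow_of_nonpos ht0 htj (by linarith)) ht0.le)
      (by have := ht0.trans_le htj; positivity) (by positivity)
  · have h1 : 0 < e := by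
      have := exp_lt_exp_of_mem_cell h hz he
      linarith
    have hl : label a ≤ label j := by
      unfold label
      have : (a : ℕ) ≤ (j : ℕ) := h.le
      have : ((a : ℕ) : ℝ) ≤ (j : ℕ) := by exact_mod_cast this
      linarith
    rw [Set.indicator_of_notMem (s := Set.Iio 0) (by simp [h1.le]),
      Set.indicator_of_mem (by exact h1), add_zero, hexp, max_eq_right hl, min_eq_left hl]
    have e1 : (t / s) ^ γ = t ^ (γ - 1) * (s ^ (-γ) * t) := by
      rw [Real.div_rpow ht0.le hs0.le, Real.rpow_sub ht0, Real.rpow_one, Real.rpow_neg hs0.le]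
      field_simp
    rw [e1]
    exact mul_le_mul (Real.rpow_le_rpow_of_nonpos ht0 htj (by linarith))
      (mul_le_mul_of_nonneg_right (Real.rpow_le_rpow_of_nonpos hs0 hsa (by linarith)) ht0.le)
      (by have := hs0.trans_le hsa; positivity) (by positivity)

/-- Integrate the density bound over the cell of `j`, where `n exp` has total mass one. -/
theorem le_intensity_cell {n : ℕ} (hγ : 0 < γ) (hγ' : γ < 1) (hβ : 0 < β) {a j : Fin n}
    (hj : j ≠ a) {z : ℝ} (hz : z ∈ cell a) :
    ENNReal.ofReal
        (β * (max (label a) (label j)) ^ (γ - 1) * (min (label a) (label j)) ^ (-γ))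
      ≤ intensity γ β {e | z + e ∈ cell j} := by
  have hn := natCast_pos_of_fin a
  have hm : MeasurableSet {e : ℝ | z + e ∈ cell j} :=
    measurable_const_add z (measurableSet_cell j)
  set K := β * (max (label a) (label j)) ^ (γ - 1) * (min (label a) (label j)) ^ (-γ) with hK
  have hK0 : 0 ≤ K := by
    have h1 : 0 ≤ label a := by unfold label; positivity
    have h2 : 0 ≤ label j := by unfold label; positivity
    have h3 : 0 ≤ max (label a) (label j) := h1.trans (le_max_left _ _)
    have h4 : 0 ≤ min (label a) (label j) := le_min h1 h2
    positivity
  unfold intensity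
  rw [withDensity_apply _ hm]
  calc ENNReal.ofReal K
      = ENNReal.ofReal (K * n) * ∫⁻ y in cell j, ENNReal.ofReal (Real.exp y) := by
        rw [lintegral_exp_cell, ENNReal.ofReal_mul hK0, ENNReal.ofReal_natCast, mul_assoc,
          one_div, ENNReal.mul_inv_cancel (by exact_mod_cast hn.ne') (ENNReal.natCast_ne_top n),
          mul_one]
    _ = ENNReal.ofReal (K * n) *
          ∫⁻ e in {e | z + e ∈ cell j}, ENNReal.ofReal (Real.exp (z + e)) := by
        congr 1
        exact ((measurePreserving_add_left (volume : Measure ℝ) z).setLIntegral_comp_preimage_emb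
          (MeasurableEquiv.addLeft z).measurableEmbedding
          (fun y => ENNReal.ofReal (Real.exp y)) (cell j)).symm
    _ = ∫⁻ e in {e | z + e ∈ cell j}, ENNReal.ofReal (K * (n * Real.exp (z + e))) := by
        rw [← lintegral_const_mul' _ _ ENNReal.ofReal_ne_top]
        refine lintegral_congr fun e => ?_
        rw [← ENNReal.ofReal_mul (by positivity), mul_assoc]
    _ ≤ _ := setLIntegral_mono (measurable_intensity_density γ β) fun e he =>
        ENNReal.ofReal_le_ofReal (le_density_of_mem_cell hγ hγ' hβ hj hz he)

theorem edgeProb_comm {n : ℕ} (i j : Fin n) : edgeProb γ β n i j = edgeProb γ β n j i := by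
  simp only [edgeProb, kernel, max_comm, min_comm]

theorem edgeProb_le {n : ℕ} (i j : Fin n) :
    edgeProb γ β n i j
      ≤ β * (max (label i) (label j)) ^ (γ - 1) * (min (label i) (label j)) ^ (-γ) := by
  have hn := natCast_pos_of_fin i
  have h1 : 0 ≤ label i := by unfold label; positivity
  have h2 : 0 ≤ label j := by unfold label; positivity
  have h3 : 0 ≤ max (label i) (label j) := h1.trans (le_max_left _ _)
  have h4 : 0 ≤ min (label i) (label j) := le_min h1 h2
  refine (min_le_left _ _).trans (le_of_eq ?_)
  unfold kernel
  rw [max_div_div_right hn.le, min_div_div_right hn.le, Real.div_rpow h3 hn.le,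
    Real.div_rpow h4 hn.le]
  -- The kernel is homogeneous of degree `-1`, which cancels the prefactor `1/n`.
  have e1 : (n : ℝ) ^ (γ - 1) * (n : ℝ) ^ (-γ) * n = 1 := by
    rw [← Real.rpow_add hn, show γ - 1 + -γ = -1 by ring, Real.rpow_neg_one,
      inv_mul_cancel₀ hn.ne']
  have e2 : (n : ℝ) ^ (γ - 1) ≠ 0 := (Real.rpow_pos_of_pos hn _).ne'
  have e3 : (n : ℝ) ^ (-γ) ≠ 0 := (Real.rpow_pos_of_pos hn _).ne'
  field_simp
  linear_combination (-(β * (max (label i) (label j)) ^ (γ - 1)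
    * (min (label i) (label j)) ^ (-γ))) * e1

/-- Here the gap between `β` and `β'` is spent. With `r = β'/β`, `exp (-r q) ≤ 1/(1 + r q)`, and
this is at most `1 - q` as soon as `q ≤ 1 - 1/r`. -/
theorem le_one_sub_exp_neg {β' q x : ℝ} (hβ : 0 < β) (hββ' : β < β') (hq : 0 ≤ q)
    (hq' : q ≤ 1 - β / β') (hx : β' / β * q ≤ x) : q ≤ 1 - Real.exp (-x) := by
  have hβ' : 0 < β' := hβ.trans hββ'
  have h1 : Real.exp (-x) ≤ Real.exp (-(β' / β * q)) := Real.exp_le_exp.2 (by linarith)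
  have h2 : β' / β * q + 1 ≤ Real.exp (β' / β * q) := Real.add_one_le_exp _
  have hr : 0 < β' / β * q + 1 := by positivity
  have h3 : Real.exp (-(β' / β * q)) ≤ (β' / β * q + 1)⁻¹ := by
    rw [Real.exp_neg]
    exact inv_anti₀ hr h2
  have h4 : (β' / β * q + 1)⁻¹ ≤ 1 - q := by
    rw [inv_le_iff_one_le_mul₀ hr]
    have h5 : β' / β * (β / β') = 1 := by field_simp
    have h6 : 0 ≤ β' / β * q * (1 - β / β' - q) :=
      mul_nonneg (by positivity) (by linarith)
    nlinarith
  linarith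

/-- The larger label is at least that of `a` and the smaller one at least `1`, so a large label of
`a` makes the edge probability small uniformly in `j`. -/
theorem edgeProb_le_one_sub_exp {β' : ℝ} {n : ℕ} (hγ : 0 < γ) (hγ' : γ < 1) (hβ : 0 < β)
    (hββ' : β < β') {a j : Fin n} (ha : β * (label a) ^ (γ - 1) ≤ 1 - β / β') (hj : j ≠ a) {z : ℝ}
    (hz : z ∈ cell a) (hfin : intensity γ β' {e | z + e ∈ cell j} ≠ ⊤) :
    edgeProb γ β n a j ≤ 1 - Real.exp (-(intensity γ β' {e | z + e ∈ cell j}).toReal) := by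
  have h1 : 1 ≤ label a := by unfold label; simp
  have h2 : 1 ≤ label j := by unfold label; simp
  set M := max (label a) (label j)
  set m := min (label a) (label j)
  have hM : label a ≤ M := le_max_left _ _
  have hm : 1 ≤ m := le_min h1 h2
  refine (edgeProb_le a j).trans (le_one_sub_exp_neg hβ hββ' (by positivity) ?_ ?_)
  · refine le_trans ?_ ha
    have h3 : M ^ (γ - 1) ≤ label a ^ (γ - 1) :=
      Real.rpow_le_rpow_of_nonpos (by linarith) hM (by linarith)
    have h4 : m ^ (-γ) ≤ 1 := Real.rpow_le_one_of_one_le_of_nonpos hm (by linarith)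
    have h5 : 0 ≤ M ^ (γ - 1) := by positivity
    calc β * M ^ (γ - 1) * m ^ (-γ) ≤ β * M ^ (γ - 1) * 1 := by gcongr
      _ ≤ β * label a ^ (γ - 1) := by rw [mul_one]; gcongr
  · have h3 := ENNReal.toReal_mono hfin (le_intensity_cell hγ hγ' (hβ.trans hββ') hj hz)
    rw [ENNReal.toReal_ofReal (by have := hβ.trans hββ'; positivity)] at h3
    refine le_trans (le_of_eq ?_) h3
    field_simp

end Intensity

/-! ### Recovering the required laws from image measures -/

open unitInterval

section Transfer

theorem IsOrderedPoissonProcess.of_measurePreserving {Ω : Type*} [MeasurableSpace Ω]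
    {P : Measure Ω} {μ : Measure (ℕ → ℝ)} {ν : Measure ℝ} (hμ : IsOrderedPoissonProcess μ ν id)
    {p : Ω → ℕ → ℝ} (hp : MeasurePreserving p P μ) : IsOrderedPoissonProcess P ν p := by
  refine ⟨hp.measurable, hp.quasiMeasurePreserving.ae hμ.monotone, fun m B c hB hd hf => ?_⟩
  rw [← hμ.counts m B c hB hd hf]
  refine hp.measure_preimage (MeasurableSet.nullMeasurableSet ?_)
    (s := {e | ∀ i, {k | id e k ∈ B i}.encard = (c i : ℕ∞)})
  rw [Set.ofPred_forall]
  exact MeasurableSet.iInter fun j =>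
    measurableSet_encard_eq (f := fun p : ℕ → ℝ => {k | p k ∈ B j})
      (fun k => measurable_pi_apply (X := fun _ : ℕ => ℝ) k (hB j)) (c j)

theorem isPoissonDisplacements_of_measurePreserving {Ω : Type*} [MeasurableSpace Ω]
    {P : Measure Ω} [IsProbabilityMeasure P] {μ : Measure (ℕ → ℝ)} [IsProbabilityMeasure μ]
    {ν : Measure ℝ} (hμ : IsOrderedPoissonProcess μ ν id) {D : Ω → List ℕ → ℕ → ℝ}
    (hD : MeasurePreserving D P (Measure.infinitePi fun _ => μ)) :
    IsPoissonDisplacements P ν fun v ω => D ω v := by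
  have h1 : ∀ v, MeasurePreserving (fun ω => D ω v) P μ := fun v =>
    (measurePreserving_eval_infinitePi (fun _ : List ℕ => μ) v).comp hD
  refine ⟨fun v => hμ.of_measurePreserving (h1 v), ?_⟩
  rw [iIndepFun_iff_map_fun_eq_infinitePi_map fun v => (h1 v).measurable]
  simp_rw [fun v => (h1 v).map_eq]
  exact hD.map_eq

end Transfer

section Graph

variable {n : ℕ}

/-- The law of the inhomogeneous random graph together with an independent uniform vertex. -/
noncomputable def graphVertexLaw (γ β : ℝ) (n : ℕ) : Measure (SimpleGraph (Fin n) × Fin n) :=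
  ((labelsLaw n).map (thresholdGraph (edgeProb γ β n))).prod ((n : ENNReal)⁻¹ • Measure.count)

instance (γ β : ℝ) : IsProbabilityMeasure ((labelsLaw n).map (thresholdGraph (edgeProb γ β n))) :=
  Measure.isProbabilityMeasure_map (measurable_thresholdGraph _).aemeasurable

instance [NeZero n] : IsProbabilityMeasure ((n : ENNReal)⁻¹ • (Measure.count : Measure (Fin n))) :=
  ⟨by
    rw [Measure.smul_apply, Measure.count_univ]
    simp [ENNReal.inv_mul_cancel, NeZero.ne n]⟩

instance (γ β : ℝ) [NeZero n] : IsProbabilityMeasure (graphVertexLaw γ β n) := by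
  unfold graphVertexLaw; infer_instance

theorem edgeProb_mem {γ β : ℝ} (hβ : 0 ≤ β) (i j : Fin n) : edgeProb γ β n i j ∈ I := by
  have h1 : 0 ≤ label i := by unfold label; positivity
  have h2 : 0 ≤ label j := by unfold label; positivity
  have h3 : 0 ≤ max (label i / n) (label j / n) := (by positivity : 0 ≤ label i / n).trans
    (le_max_left _ _)
  have h4 : 0 ≤ min (label i / n) (label j / n) := le_min (by positivity) (by positivity)
  refine ⟨le_min ?_ zero_le_one, min_le_right _ _⟩
  unfold kernel
  positivity

theorem labelsLaw_edge {q : ℝ} (hq : q ∈ I) (e : Sym2 (Fin n)) :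
    labelsLaw n {u | (u e : ℝ) < q} = ENNReal.ofReal q := by
  have h := (measurePreserving_eval_infinitePi (fun _ : Sym2 (Fin n) => (volume : Measure I)) e)
  have h2 := h.measure_preimage (s := Set.Iio (⟨q, hq⟩ : I)) measurableSet_Iio.nullMeasurableSet
  rw [unitInterval.volume_Iio] at h2
  exact h2

theorem isPARandomGraph_of_map_eq {γ β : ℝ} (hβ : 0 ≤ β) {Ω : Type*} [MeasurableSpace Ω]
    {P : Measure Ω} {G : Ω → SimpleGraph (Fin n)} (hG : Measurable G)
    (h : P.map G = (labelsLaw n).map (thresholdGraph (edgeProb γ β n))) :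
    IsPARandomGraph P γ β G := by
  have key : ∀ s : Set (SimpleGraph (Fin n)), P {ω | G ω ∈ s}
      = labelsLaw n {u | thresholdGraph (edgeProb γ β n) u ∈ s} := by
    intro s
    have := congrArg (fun μ => μ s) h
    rwa [Measure.map_apply hG .of_discrete,
      Measure.map_apply (measurable_thresholdGraph _) .of_discrete] at this
  have hadj : ∀ i j : Fin n, i < j →
      {u | (thresholdGraph (edgeProb γ β n) u).Adj i j}
        = {u | (u s(i, j) : ℝ) < edgeProb γ β n i j} := by
    intro i j hij
    ext u
    simp [thresholdGraph, hij.ne, min_eq_left hij.le, max_eq_right hij.le]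
  have hprob : ∀ i j : Fin n, i < j →
      labelsLaw n {u | (thresholdGraph (edgeProb γ β n) u).Adj i j}
        = ENNReal.ofReal (edgeProb γ β n i j) := fun i j hij => by
    rw [hadj i j hij, labelsLaw_edge (edgeProb_mem hβ i j)]
  have hPprob : ∀ i j : Fin n, P {ω | (G ω).Adj i j}
      = labelsLaw n {u | (thresholdGraph (edgeProb γ β n) u).Adj i j} :=
    fun i j => key {g | g.Adj i j}
  refine ⟨hG, fun i j hij => (hPprob i j).trans (hprob i j hij), ?_⟩
  have hmeas : ∀ i j : Fin n, MeasurableSet {ω | (G ω).Adj i j} := fun i j =>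
    hG (MeasurableSet.of_discrete (s := {g : SimpleGraph (Fin n) | g.Adj i j}))
  rw [iIndepSet_iff_meas_biInter fun e => hmeas _ _]
  intro S
  -- Ordered pairs `i < j` correspond to different coordinates of the label family, whence the
  -- independence of the edges.
  have hinj : Function.Injective fun e : {e : Fin n × Fin n // e.1 < e.2} =>
      s(e.1.1, e.1.2) := by
    rintro ⟨⟨i, j⟩, hij⟩ ⟨⟨i', j'⟩, hij'⟩ he
    simp only [Sym2.eq_iff] at he
    simp only at hij hij'
    rcases he with ⟨rfl, rfl⟩ | ⟨rfl, rfl⟩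
    · rfl
    · exact absurd hij (not_lt_of_gt hij')
  have hind : iIndepFun (fun (e : {e : Fin n × Fin n // e.1 < e.2}) (u : Sym2 (Fin n) → I) =>
      u s(e.1.1, e.1.2)) (labelsLaw n) :=
    (iIndepFun_infinitePi (P := fun _ : Sym2 (Fin n) => (volume : Measure I)) (X := fun _ => id)
      fun _ => measurable_id).precomp hinj
  have h1 := hind.measure_inter_preimage_eq_mul S
    (sets := fun e => {x : I | (x : ℝ) < edgeProb γ β n e.1.1 e.1.2})
    (fun e _ => measurableSet_lt measurable_subtype_coe measurable_const)
  have h2 := key (⋂ e ∈ S, {g | g.Adj e.1.1 e.1.2})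
  have e1 : {ω | G ω ∈ ⋂ e ∈ S, {g | g.Adj e.1.1 e.1.2}}
      = ⋂ e ∈ S, {ω | (G ω).Adj e.1.1 e.1.2} := by
    ext ω
    simp
  have e2 : {u | thresholdGraph (edgeProb γ β n) u ∈ ⋂ e ∈ S, {g | g.Adj e.1.1 e.1.2}}
      = ⋂ e ∈ S, (fun u : Sym2 (Fin n) → I => u s(e.1.1, e.1.2)) ⁻¹'
        {x : I | (x : ℝ) < edgeProb γ β n e.1.1 e.1.2} := by
    ext u
    simp only [Set.mem_ofPred_eq, Set.mem_iInter, Set.mem_preimage]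
    exact forall₂_congr fun e _ => Set.ext_iff.1 (hadj _ _ e.2) u
  rw [e1, e2, h1] at h2
  rw [h2]
  refine Finset.prod_congr rfl fun e _ => ?_
  rw [hPprob, hadj _ _ e.2]
  rfl

theorem isIndepUniformVertex_of_map_eq {γ β : ℝ} [NeZero n] {Ω : Type*} [MeasurableSpace Ω]
    {P : Measure Ω} [IsProbabilityMeasure P] {f : Ω → SimpleGraph (Fin n) × Fin n}
    (hf : Measurable f) (h : P.map f = graphVertexLaw γ β n) :
    IsIndepUniformVertex P (fun ω => (f ω).1) fun ω => (f ω).2 := by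
  have hf1 : Measurable fun ω => (f ω).1 := measurable_fst.comp hf
  have hf2 : Measurable fun ω => (f ω).2 := measurable_snd.comp hf
  have h1 : P.map (fun ω => (f ω).1)
      = (labelsLaw n).map (thresholdGraph (edgeProb γ β n)) := by
    have := congrArg (fun μ => μ.map Prod.fst) h
    rw [Measure.map_map measurable_fst hf, graphVertexLaw, Measure.map_fst_prod, measure_univ,
      one_smul] at this
    exact this
  have h2 : P.map (fun ω => (f ω).2) = (n : ENNReal)⁻¹ • Measure.count := by
    have := congrArg (fun μ => μ.map Prod.snd) h
    rw [Measure.map_map measurable_snd hf, graphVertexLaw, Measure.map_snd_prod, measure_univ,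
      one_smul] at this
    exact this
  refine ⟨hf2, fun i => ?_, ?_⟩
  · have := congrArg (fun μ => μ {i}) h2
    rw [Measure.map_apply hf2 (measurableSet_singleton _), Measure.smul_apply, Measure.count_singleton] at this
    exact (Eq.trans this (by simp) : _ = 1 / (n : ENNReal))
  · refine IndepFun.symm ?_
    rw [indepFun_iff_map_prod_eq_prod_map_map hf1.aemeasurable hf2.aemeasurable, h1, h2]
    exact h

theorem componentSize_le (G : SimpleGraph (Fin n)) (v : Fin n) : componentSize G v ≤ n := by
  unfold componentSize
  refine (Set.encard_le_encard (Set.subset_univ _)).trans ?_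
  simp [Set.encard_univ]

end Graph

/-! ### Comparing the sizes -/

section Assembly

/-- The walk has more than `k` particles, or a particle located in `(-∞, l]`. -/
def walkEvent (k : ℕ) (l : ℝ) : Set (ℝ × (List ℕ → ℕ → ℝ)) :=
  {a | (k : ℕ∞) < (killedWalk (-a.1) a.2).encard ∨
    ∃ v ∈ killedWalk (-a.1) a.2, position (-a.1) a.2 v ≤ l}

theorem measurableSet_walkEvent (k : ℕ) (l : ℝ) : MeasurableSet (walkEvent k l) := by
  have hm : Measurable fun a : ℝ × (List ℕ → ℕ → ℝ) => (-a.1, a.2) := by fun_prop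
  have h3 : walkEvent k l = {a | (k : ℕ∞) < (killedWalk (-a.1) a.2).encard} ∪
      ⋃ v : List ℕ, {a | v ∈ killedWalk (-a.1) a.2} ∩ {a | position (-a.1) a.2 v ≤ l} := by
    ext a
    simp only [walkEvent, Set.mem_ofPred_eq, Set.mem_union, Set.mem_iUnion, Set.mem_inter_iff]
  rw [h3]
  refine (measurableSet_lt_encard (fun v => hm (measurableSet_mem_killedWalk v)) k).union ?_
  exact MeasurableSet.iUnion fun v => (hm (measurableSet_mem_killedWalk v)).inter
    (hm (measurableSet_le (measurable_position v) measurable_const))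

/-- The number of `k < n` for which the walk has more than `k` particles or a particle located in
`(-∞, l]`. -/
noncomputable def cappedSize (n : ℕ) (l : ℝ) (a : ℝ × (List ℕ → ℕ → ℝ)) : ℕ :=
  ∑ k ∈ Finset.range n, (walkEvent k l).indicator (fun _ => 1) a

theorem measurable_cappedSize (n : ℕ) (l : ℝ) : Measurable (cappedSize n l) :=
  Finset.measurable_fun_sum _ fun k _ => measurable_const.indicator (measurableSet_walkEvent k l)

theorem walkEvent_anti {j k : ℕ} (hjk : j ≤ k) (l : ℝ) : walkEvent k l ⊆ walkEvent j l :=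
  fun _ ha => ha.imp_left fun h => lt_of_le_of_lt (by exact_mod_cast hjk) h

/-- The events decrease in `k`, so the one at `k` brings with it all `k + 1` indices up to `k`. -/
theorem lt_cappedSize {n k : ℕ} (hk : k < n) {l : ℝ} {a : ℝ × (List ℕ → ℕ → ℝ)}
    (ha : a ∈ walkEvent k l) : k < cappedSize n l a := by
  have h1 : ∑ j ∈ Finset.range (k + 1), (walkEvent j l).indicator (fun _ => 1) a
      ≤ cappedSize n l a :=
    Finset.sum_le_sum_of_subset (Finset.range_mono hk)
  have h2 : ∑ j ∈ Finset.range (k + 1), (walkEvent j l).indicator (fun _ => 1) a = k + 1 := by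
    rw [Finset.sum_congr rfl fun j hj => Set.indicator_of_mem (walkEvent_anti
      (Nat.lt_succ_iff.1 (Finset.mem_range.1 hj)) l ha) _]
    simp
  omega

theorem cappedSize_le {n t : ℕ} {l : ℝ} {a : ℝ × (List ℕ → ℕ → ℝ)}
    (ht : (killedWalk (-a.1) a.2).encard = t)
    (ha : ¬ ∃ v ∈ killedWalk (-a.1) a.2, position (-a.1) a.2 v ≤ l) : cappedSize n l a ≤ t := by
  unfold cappedSize
  have h1 : ∀ k, (walkEvent k l).indicator (fun _ => 1) a ≤ if k < t then 1 else 0 := by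
    intro k
    by_cases hk : k < t
    · simp only [hk, if_true]
      exact Set.indicator_le_self' (fun _ _ => zero_le) a
    · rw [Set.indicator_of_notMem]
      · simp
      · rintro (h | h)
        · rw [ht] at h
          exact hk (by exact_mod_cast h)
        · exact ha h
  refine (Finset.sum_le_sum fun k _ => h1 k).trans ?_
  rw [← Finset.sum_filter, Finset.sum_const, smul_eq_mul, mul_one]
  calc ((Finset.range n).filter (· < t)).card ≤ (Finset.range t).card :=
        Finset.card_le_card fun k hk => by simpa using (Finset.mem_filter.1 hk).2
    _ = t := Finset.card_range t

/-- Condition on the uniform vertex being `i` and, correspondingly, on `-X` lying in the cell of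
`i`; both have probability `1/n`, and the domination holds for every starting point in the cell. -/
theorem graphVertexLaw_lt_componentSize_le {γ β β' ε : ℝ} (hγ : 0 < γ) (hγ' : γ < 1) (hβ : 0 < β)
    (hββ' : β < β') {μ : Measure (ℕ → ℝ)} [IsProbabilityMeasure μ]
    (hμ : IsOrderedPoissonProcess μ (intensity γ β') id) {n : ℕ} [NeZero n]
    (hn : β * ((n : ℝ) ^ ε) ^ (γ - 1) ≤ 1 - β / β') (k : ℕ) :
    graphVertexLaw γ β n {s | (k : ℕ∞) < componentSize s.1 s.2}
      ≤ ((expMeasure 1).prod (Measure.infinitePi fun _ : List ℕ => μ))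
          (walkEvent k (-(1 - ε) * Real.log n)) := by
  set l := -(1 - ε) * Real.log n with hl
  have hn0 : (0 : ℝ) < n := by exact_mod_cast NeZero.pos n
  have : IsProbabilityMeasure (expMeasure 1) := isProbabilityMeasure_expMeasure one_pos
  -- The threshold `n^ε` serves twice: cells up to it lie below `log (n^ε / n) = l`, and beyond it
  -- edge probabilities are small enough for the comparison.
  set L : Set (Fin n) := {a | label a ≤ (n : ℝ) ^ ε} with hLdef
  have hL : ∀ a ∈ L, cell a ⊆ Set.Iic l := by
    intro a ha z hz
    have h1 : Real.exp z ≤ (n : ℝ) ^ ε / n := hz.2.trans (by gcongr; exact ha)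
    have h2 : (n : ℝ) ^ ε / n = Real.exp l := by
      rw [hl, Real.rpow_def_of_pos hn0]
      nth_rewrite 2 [← Real.exp_log hn0]
      rw [← Real.exp_sub]
      ring_nf
    rw [h2] at h1
    exact Real.exp_le_exp.1 h1
  have hfin : ∀ (z : ℝ) (j : Fin n), intensity γ β' {e | z + e ∈ cell j} ≠ ⊤ := by
    intro z j
    refine ((measure_mono ?_).trans_lt
      (intensity_Iic_ne_top hγ hγ' (hβ.trans hββ').le (-z)).lt_top).ne
    intro e he
    have : z + e ≤ 0 := cell_subset_Iic j he
    simp only [Set.mem_Iic]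
    linarith
  have hp : ∀ a ∉ L, ∀ z ∈ cell a, ∀ j, j ≠ a → edgeProb γ β n (min a j) (max a j)
      ≤ 1 - Real.exp (-(intensity γ β' {e | z + e ∈ cell j}).toReal) := by
    intro a ha z hz j hj
    have h1 : edgeProb γ β n (min a j) (max a j) = edgeProb γ β n a j := by
      rcases le_total a j with h | h
      · rw [min_eq_left h, max_eq_right h]
      · rw [min_eq_right h, max_eq_left h, edgeProb_comm]
    rw [h1]
    refine edgeProb_le_one_sub_exp hγ hγ' hβ hββ' (le_trans ?_ hn) hj hz (hfin z j)
    have h2 : (n : ℝ) ^ ε < label a := not_le.1 ha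
    have h3 := Real.rpow_le_rpow_of_nonpos (z := γ - 1) (Real.rpow_pos_of_pos hn0 ε) h2.le
      (by linarith)
    gcongr
  have hcell : ∀ (i : Fin n), ∀ x ∈ {x : ℝ | -x ∈ cell i},
      labelsLaw n {u | thresholdGraph (edgeProb γ β n) u ∈ reachEvent k L Set.univ {i}}
        ≤ Measure.infinitePi (fun _ : List ℕ => μ) (Prod.mk x ⁻¹' walkEvent k l) := by
    intro i x hx
    refine (labelsLaw_reachEvent_le (edgeProb γ β n) hμ measurableSet_cell pairwise_disjoint_cell
      cell_subset_Iic hL hfin hp k Set.univ {i} {[]} (fun _ => -x) ?_ ?_ ?_).trans ?_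
    · rintro v rfl w rfl -
      rfl
    · rintro w -
      exact cell_subset_Iic i hx
    · rintro a rfl
      exact ⟨[], rfl, hx⟩
    · exact measure_mono fun d hd => (forestEvent_root k l (-x)).1 hd
  have hS : MeasurableSet {s : SimpleGraph (Fin n) × Fin n | (k : ℕ∞) < componentSize s.1 s.2} :=
    .of_discrete
  calc graphVertexLaw γ β n {s | (k : ℕ∞) < componentSize s.1 s.2}
      = ∑ i : Fin n, (n : ENNReal)⁻¹ * labelsLaw n
          {u | (k : ℕ∞) < componentSize (thresholdGraph (edgeProb γ β n) u) i} := by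
        rw [graphVertexLaw, Measure.prod_apply_symm hS, lintegral_smul_measure, lintegral_count,
          tsum_fintype, smul_eq_mul, Finset.mul_sum]
        refine Finset.sum_congr rfl fun i _ => ?_
        rw [Measure.map_apply (measurable_thresholdGraph _) .of_discrete]
        rfl
    _ ≤ ∑ i : Fin n, ∫⁻ x in {x : ℝ | -x ∈ cell i},
          Measure.infinitePi (fun _ : List ℕ => μ) (Prod.mk x ⁻¹' walkEvent k l)
            ∂(expMeasure 1) := by
        refine Finset.sum_le_sum fun i _ => ?_
        have hm : MeasurableSet {x : ℝ | -x ∈ cell i} := measurable_neg (measurableSet_cell i)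
        calc (n : ENNReal)⁻¹ * labelsLaw n
              {u | (k : ℕ∞) < componentSize (thresholdGraph (edgeProb γ β n) u) i}
            ≤ (n : ENNReal)⁻¹ * labelsLaw n
              {u | thresholdGraph (edgeProb γ β n) u ∈ reachEvent k L Set.univ {i}} := by
              gcongr with u
              exact fun hu => lt_encard_supp_imp_mem_reachEvent hu
          _ = ∫⁻ _ in {x : ℝ | -x ∈ cell i}, labelsLaw n
              {u | thresholdGraph (edgeProb γ β n) u ∈ reachEvent k L Set.univ {i}}
                ∂(expMeasure 1) := by
              rw [setLIntegral_const, expMeasure_neg_mem_cell, one_div, mul_comm]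
          _ ≤ _ := setLIntegral_mono
              (measurable_measure_prodMk_left (measurableSet_walkEvent k l)) (hcell i)
    _ = ∫⁻ x in ⋃ i : Fin n, {x : ℝ | -x ∈ cell i},
          Measure.infinitePi (fun _ : List ℕ => μ) (Prod.mk x ⁻¹' walkEvent k l)
            ∂(expMeasure 1) := by
        rw [lintegral_iUnion (s := fun i : Fin n => {x : ℝ | -x ∈ cell i})
          (fun i => measurable_neg (measurableSet_cell i))
          (fun i j hij => (pairwise_disjoint_cell hij).preimage _), tsum_fintype]
    _ ≤ ∫⁻ x, Measure.infinitePi (fun _ : List ℕ => μ) (Prod.mk x ⁻¹' walkEvent k l)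
            ∂(expMeasure 1) := setLIntegral_le_lintegral _ _
    _ = _ := (Measure.prod_apply (measurableSet_walkEvent k l)).symm

theorem eventually_mul_rpow_le {γ β β' ε : ℝ} (hγ' : γ < 1) (hβ : 0 < β) (hββ' : β < β')
    (hε : 0 < ε) : ∀ᶠ n : ℕ in atTop, β * ((n : ℝ) ^ ε) ^ (γ - 1) ≤ 1 - β / β' := by
  have h1 : Tendsto (fun n : ℕ => β * ((n : ℝ) ^ ε) ^ (γ - 1)) atTop (nhds (β * 0)) := by
    refine Tendsto.const_mul β ?_
    have h2 := tendsto_rpow_neg_atTop (sub_pos.2 hγ')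
    have h3 := h2.comp ((tendsto_rpow_atTop hε).comp tendsto_natCast_atTop_atTop)
    simpa [Function.comp_def] using h3
  have h4 : β * 0 < 1 - β / β' := by
    have : β / β' < 1 := (div_lt_one (hβ.trans hββ')).2 hββ'
    linarith
  exact (h1.eventually_lt_const h4).mono fun n hn => hn.le

end Assembly

end PrefAttach

/-! ### The coupling -/

theorem mainTheorem7 (γ β β' ε : ℝ) (hγ : 0 < γ) (hγ' : γ < 1 / 2)
    (hβ : 0 < β) (hββ' : β < β') (hβ' : β' < PrefAttach.betaC γ) (hε : 0 < ε) :
    ∃ (Ω : Type) (_ : MeasurableSpace Ω) (P : Measure Ω) (_ : IsProbabilityMeasure P)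
      (X : Ω → ℝ) (D : List ℕ → Ω → ℕ → ℝ),
      HasLaw X (expMeasure 1) P ∧
      PrefAttach.IsPoissonDisplacements P (PrefAttach.intensity γ β') D ∧
      IndepFun X (fun ω v => D v ω) P ∧
      ∀ᶠ n : ℕ in atTop, ∃ (G : Ω → SimpleGraph (Fin n)) (O : Ω → Fin n),
        PrefAttach.IsPARandomGraph P γ β G ∧
        PrefAttach.IsIndepUniformVertex P G O ∧
        P {ω | (PrefAttach.killedWalk (-X ω) (fun v => D v ω)).encard
              < PrefAttach.componentSize (G ω) (O ω)}
          ≤ P {ω | ∃ v ∈ PrefAttach.killedWalk (-X ω) (fun v => D v ω),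
              PrefAttach.position (-X ω) (fun v => D v ω) v ≤ -(1 - ε) * Real.log n} := by
  have hγ1 : γ < 1 := by linarith
  obtain ⟨μ, hμp, hμ⟩ := PrefAttach.exists_isOrderedPoissonProcess (PrefAttach.intensity γ β')
    (PrefAttach.intensity_Iic_ne_top hγ hγ1 (hβ.trans hββ').le)
    (PrefAttach.intensity_univ hγ (hβ.trans hββ'))
  have : IsProbabilityMeasure (expMeasure 1) := isProbabilityMeasure_expMeasure one_pos
  set Q : Measure (ℝ × (List ℕ → ℕ → ℝ)) :=
    (expMeasure 1).prod (Measure.infinitePi fun _ => μ) with hQ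
  have hfst : MeasurePreserving (Prod.fst : (ℝ × (List ℕ → ℕ → ℝ)) × unitInterval → _)
      (Q.prod volume) Q := measurePreserving_fst
  have hX : MeasurePreserving (fun ω : (ℝ × (List ℕ → ℕ → ℝ)) × unitInterval => ω.1.1)
      (Q.prod volume) (expMeasure 1) := measurePreserving_fst.comp hfst
  have hD : MeasurePreserving (fun ω : (ℝ × (List ℕ → ℕ → ℝ)) × unitInterval => ω.1.2)
      (Q.prod volume) (Measure.infinitePi fun _ => μ) := measurePreserving_snd.comp hfst
  -- The uniform coordinate supplies the randomness of the graph and the vertex. It is reused for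
  -- every `n`, since no joint law over different `n` is prescribed.
  refine ⟨(ℝ × (List ℕ → ℕ → ℝ)) × unitInterval, inferInstance, Q.prod volume, inferInstance,
    fun ω => ω.1.1, fun v ω => ω.1.2 v, ⟨hX.measurable.aemeasurable, hX.map_eq⟩,
    PrefAttach.isPoissonDisplacements_of_measurePreserving hμ hD, ?_, ?_⟩
  · rw [indepFun_iff_map_prod_eq_prod_map_map hX.measurable.aemeasurable
      hD.measurable.aemeasurable, hX.map_eq]
    refine Eq.trans hfst.map_eq ?_
    rw [hQ]
    congr 1
    exact hD.map_eq.symm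
  · filter_upwards [PrefAttach.eventually_mul_rpow_le hγ1 hβ hββ' hε, eventually_ge_atTop 1]
      with n hn hn1
    have : NeZero n := ⟨by omega⟩
    set l := -(1 - ε) * Real.log n with hl
    obtain ⟨f, hf, hflaw, hfle⟩ := PrefAttach.exists_monotone_coupling Q
      (PrefAttach.measurable_cappedSize n l) (PrefAttach.graphVertexLaw γ β n)
      (N := fun s => (PrefAttach.componentSize s.1 s.2).toNat) .of_discrete (by
        intro k
        have hNtop : ∀ s : SimpleGraph (Fin n) × Fin n,
            ((PrefAttach.componentSize s.1 s.2).toNat : ℕ∞) = PrefAttach.componentSize s.1 s.2 :=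
          fun s => ENat.natCast_toNat (ne_top_of_le_ne_top (ENat.natCast_ne_top n)
            (PrefAttach.componentSize_le s.1 s.2))
        by_cases hk : k < n
        · refine le_trans (measure_mono fun s hs => ?_)
            ((PrefAttach.graphVertexLaw_lt_componentSize_le hγ hγ1 hβ hββ' hμ hn k).trans
              (measure_mono fun a ha => PrefAttach.lt_cappedSize hk ha))
          simp only [Set.mem_ofPred_eq] at hs ⊢
          rw [← hNtop s]
          exact_mod_cast hs
        -- For `k ≥ n` no component is large enough, so capping the size at `n` loses nothing.
        · have : {s : SimpleGraph (Fin n) × Fin n |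
              k < (PrefAttach.componentSize s.1 s.2).toNat} = ∅ := by
            refine Set.eq_empty_of_forall_notMem fun s hs => hk (lt_of_lt_of_le hs ?_)
            have := PrefAttach.componentSize_le s.1 s.2
            rw [← hNtop s] at this
            exact_mod_cast this
          rw [this, measure_empty]
          exact zero_le)
    refine ⟨fun ω => (f ω).1, fun ω => (f ω).2, ?_,
      PrefAttach.isIndepUniformVertex_of_map_eq hf hflaw, ?_⟩
    · refine PrefAttach.isPARandomGraph_of_map_eq hβ.le (measurable_fst.comp hf) ?_
      have := congrArg (fun ρ => ρ.map Prod.fst) hflaw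
      rw [Measure.map_map measurable_fst hf, PrefAttach.graphVertexLaw, Measure.map_fst_prod,
        measure_univ, one_smul] at this
      exact this
    -- Almost surely the first event is contained in the second: a walk smaller than the component
    -- is finite, and if it avoids the low region, `cappedSize` is at most its size, contradicting
    -- the coupling.
    · refine measure_mono_ae ?_
      filter_upwards [hfle] with ω hω hlt
      by_contra hno
      have hlt' : (PrefAttach.killedWalk (-ω.1.1) ω.1.2).encard
          < PrefAttach.componentSize (f ω).1 (f ω).2 := hlt
      obtain ⟨t, ht⟩ := ENat.ne_top_iff_exists.1 (ne_top_of_lt hlt')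
      have h1 := PrefAttach.cappedSize_le (n := n) (l := l) ht.symm hno
      have h2 := hω.trans h1
      have h3 : PrefAttach.componentSize (f ω).1 (f ω).2 ≤ t := by
        rw [← ENat.natCast_toNat (ne_top_of_le_ne_top (ENat.natCast_ne_top n)
          (PrefAttach.componentSize_le (f ω).1 (f ω).2))]
        exact_mod_cast h2
      rw [← ht] at hlt'
      exact absurd h3 (not_le_of_gt hlt')
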